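/- **Setting.** There are $n\ge 1$ participants, located at distinct points of the real line with distance $d$; each is both a voter and a candidate. Participant $x$ has utility $U_x(y)=f_x(d(x,y))$ from a win of $y$, where $f_x$ is strictly decreasing and concave on $[0,\infty)$. *Triadic Consensus* starts with an urn holding $k\ge 1$ balls labelled by each participant. While more than one label is present, three balls are drawn uniformly at random with replacement. If two of them have the same label, that label wins. Otherwise the owners $x,y,z$ vote simultaneously, each between the other two, and a participant with two votes wins. The drawn balls are relabelled with the winner's label. If each of the three received one vote (a three-way tie), a mechanism is applied: under *Remove* the three balls are removed from the urn; under *RepeatThenRemove* the three owners vote once more, the balls being relabelled if there is now a winner and removed if there is again a three-way tie. When at most one label remains, that label is returned; if no ball remains, the label of a uniformly random one of the three last removed balls is returned. A strategy of a participant gives a (possibly random) vote depending on everything observed so far: all past draws and votes, the current urn, the current draw, and any earlier vote among these balls. A profile of strategies is a *Nash equilibrium* if no participant can increase his expected utility by changing only his own strategy. A participant votes *truthfully* if he votes for the closer candidate. **Strategies.** In a vote, say that $x$ *should win* if he would win it when all three vote truthfully. * *Strategy A (for Remove).* If $x$ should win against the candidates $y,z$ (listed in either order), he votes for $y$ if $y$'s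 expected utility after a win of $x$ is at least $y$'s expected utility after the removal of the three balls, everybody voting truthfully from then on; otherwise he votes for $z$. If $x$ should not win, he votes truthfully. * *Strategy B (for RepeatThenRemove).* If $x$ should win, he votes arbitrarily in the first round, and in the second round for the candidate he did not vote for in the first round. If $x$ should not win, he votes truthfully. **Theorem.** For each of the two mechanisms and every strategy profile, the procedure returns a winner with probability $1$. For every choice of the orders of candidates in Strategy A, the profile in which all participants use Strategy A is a Nash equilibrium of Triadic Consensus with Remove. For every choice of the first-round votes in Strategy B (which may be random and history-dependent), the profile in which all participants use Strategy B is a Nash equilibrium of Triadic Consensus with RepeatThenRemove. Both profiles are quasi-truthful: each vote among three distinct participants has the same outcome as a truthful vote, and the final winner has the same probability distribution as under truthful voting. These equilibria may be non-truthful: there is an instance as above in which, for every choice of orders, Strategy A has some participant vote, with positive probability, for the strictly more distant candidate in some possible first draw, and in which Strategy B does so for some choice of the first-round votes. -/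

import Mathlib

namespace TriadicConsensus

/-- The balls of the urn: `k` balls for each of the `n` participants. -/
abbrev Ball (n k : ℕ) := Fin n × Fin k

/-- An urn: the balls still present, the current label of every ball, and the balls that were
removed last (`∅` if nothing has been removed so far). -/
@[ext]
structure Urn (n k : ℕ) where
  alive : Finset (Ball n k)
  label : Ball n k → Fin n
  removed : Finset (Ball n k)

/-- The starting urn: `k` balls for each participant, labelled by that participant. -/
def initialUrn (n k : ℕ) : Urn n k := ⟨Finset.univ, Prod.fst, ∅⟩

/-- There is more than one label in the urn. -/
def Urn.Undecided {n k : ℕ} (u : Urn n k) : Prop := 1 < (u.alive.image u.label).card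

instance {n k : ℕ} (u : Urn n k) : Decidable u.Undecided :=
  inferInstanceAs (Decidable (1 < _))

theorem Urn.Undecided.nonempty {n k : ℕ} {u : Urn n k} (h : u.Undecided) : u.alive.Nonempty :=
  Finset.image_nonempty.mp (Finset.card_pos.mp (lt_trans Nat.zero_lt_one h))

/-- Relabel all the sampled balls with the label `w`. -/
def Urn.relabel {n k : ℕ} (u : Urn n k) (s : Fin 3 → Ball n k) (w : Fin n) : Urn n k :=
  ⟨u.alive, fun b => if b ∈ Finset.univ.image s then w else u.label b, u.removed⟩

/-- Remove all the sampled balls from the urn. -/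
def Urn.remove {n k : ℕ} (u : Urn n k) (s : Fin 3 → Ball n k) : Urn n k :=
  ⟨u.alive \ Finset.univ.image s, u.label, Finset.univ.image s⟩

/-- One round of votes among three sampled balls. The owner of ball `i` votes between the other
two balls, read in the order of sampling: `true` is a vote for the earlier one and `false` is a
vote for the later one. -/
abbrev Ballot := Fin 3 → Bool

/-- The ball for which the owner of ball `i` votes by casting the vote `b`. -/
def target (i : Fin 3) (b : Bool) : Fin 3 := if b then i.succAbove 0 else i.succAbove 1

/-- The ball that received two votes, or `none` if each ball received exactly one vote. -/
def winner (v : Ballot) : Option (Fin 3) :=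
  (List.finRange 3).find? fun i => decide (∀ j, j ≠ i → target j (v j) = i)

/-- The label that occurs at least twice among three labels which are not all different. -/
def majority {n : ℕ} (l : Fin 3 → Fin n) : Fin n :=
  if l 0 = l 1 ∨ l 0 = l 2 then l 0 else l 1

/-- What happens in one pass of the loop: the sampled balls and the ballots that were held. -/
structure Event (n k : ℕ) where
  sample : Fin 3 → Ball n k
  ballots : List Ballot

/-- The urn after an event: without a vote if a label occurs twice in the sample; otherwise the
first ballot that has a winner decides, and the balls are removed if no ballot has a winner. -/
def Urn.next {n k : ℕ} (u : Urn n k) (e : Event n k) : Urn n k :=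
  if Function.Injective (u.label ∘ e.sample) then
    match e.ballots.findSome? winner with
    | some i => u.relabel e.sample (u.label (e.sample i))
    | none => u.remove e.sample
  else u.relabel e.sample (majority (u.label ∘ e.sample))

/-- What a voter knows when voting: all past events (latest first), the current urn, the current
sample, and the ballots already held among the current sample. -/
structure Situation (n k : ℕ) where
  history : List (Event n k)
  urn : Urn n k
  sample : Fin 3 → Ball n k
  ballots : List Ballot

/-- The participant whose label is on the sampled ball `i`. -/
def Situation.owner {n k : ℕ} (q : Situation n k) (i : Fin 3) : Fin n := q.urn.label (q.sample i)

/-- A (behavioural, history-dependent) strategy of a participant: the law of the vote that he casts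
in a given situation when he owns the sampled ball `i`. -/
abbrev Strategy (n k : ℕ) := Situation n k → Fin 3 → PMF Bool

/-- A strategy for every participant. -/
abbrev Profile (n k : ℕ) := Fin n → Strategy n k

/-- The three owners vote simultaneously and independently. -/
noncomputable def ballotLaw {n k : ℕ} (σ : Profile n k) (q : Situation n k) : PMF Ballot :=
  (σ (q.owner 0) q 0).bind fun a =>
    (σ (q.owner 1) q 1).bind fun b =>
      (σ (q.owner 2) q 2).map fun c => ![a, b, c]

/-- The mechanism that is used after a three-way tie: remove the three balls at once, or let the
three owners vote once more and remove the balls if there is a tie again. -/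
inductive Mechanism
  | remove
  | repeatThenRemove

open Classical in
/-- The law of one pass of the loop: three balls are drawn uniformly with replacement; if their
labels are distinct there is a vote, followed by a second one if the mechanism demands it. -/
noncomputable def eventLaw {n k : ℕ} (m : Mechanism) (σ : Profile n k) (h : List (Event n k))
    (u : Urn n k) (hu : u.alive.Nonempty) : PMF (Event n k) :=
  (PMF.uniformOfFinset (Fintype.piFinset fun _ : Fin 3 => u.alive)
    (Fintype.piFinset_nonempty.mpr fun _ => hu)).bind fun s =>
      if Function.Injective (u.label ∘ s) then
        (ballotLaw σ ⟨h, u, s, []⟩).bind fun v =>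
          if winner v = none ∧ m = Mechanism.repeatThenRemove then
            (ballotLaw σ ⟨h, u, s, [v]⟩).map fun v' => ⟨s, [v, v']⟩
          else PMF.pure ⟨s, [v]⟩
      else PMF.pure ⟨s, []⟩

/-- The law of the history and the urn after at most `t` passes of the loop, from the urn `u₀`. -/
noncomputable def runLaw {n k : ℕ} (m : Mechanism) (σ : Profile n k) (u₀ : Urn n k) :
    ℕ → PMF (List (Event n k) × Urn n k)
  | 0 => PMF.pure ([], u₀)
  | t + 1 => (runLaw m σ u₀ t).bind fun x =>
      if hx : x.2.Undecided then
        (eventLaw m σ x.1 x.2 hx.nonempty).map fun e => (e :: x.1, x.2.next e)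
      else PMF.pure x

/-- The law of the returned participant for a given urn (`none` while the loop is running): the
label of a remaining ball or, if no ball remains, of a random ball among the last removed. -/
noncomputable def report {n k : ℕ} (u : Urn n k) : PMF (Option (Fin n)) :=
  if u.Undecided then PMF.pure none
  else if h : u.alive.Nonempty then
    (PMF.uniformOfFinset u.alive h).map fun b => some (u.label b)
  else if h : u.removed.Nonempty then
    (PMF.uniformOfFinset u.removed h).map fun b => some (u.label b)
  else PMF.pure none

/-- The probability that `w` is returned, when the urn `u₀` is the starting one: the supremum over
`t` of the (nondecreasing) probabilities that `w` has been returned within `t` passes. -/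
noncomputable def winProb {n k : ℕ} (m : Mechanism) (σ : Profile n k) (u₀ : Urn n k) (w : Fin n) :
    ENNReal :=
  ⨆ t, ((runLaw m σ u₀ t).bind fun x => report x.2) (some w)

/-- Participants at the positions `p` on the line; the utility of `x` from a win of `y` is a
function `f x` of the distance. -/
def utility {n : ℕ} (p : Fin n → ℝ) (f : Fin n → ℝ → ℝ) (x y : Fin n) : ℝ := f x (dist (p x) (p y))

/-- The expected utility of `x`. -/
noncomputable def expectedUtility {n k : ℕ} (p : Fin n → ℝ) (f : Fin n → ℝ → ℝ) (m : Mechanism)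
    (σ : Profile n k) (u₀ : Urn n k) (x : Fin n) : ℝ :=
  ∑ w, (winProb m σ u₀ w).toReal * utility p f x w

/-- No participant can gain by a unilateral deviation to any other strategy. -/
def IsNashEquilibrium {n k : ℕ} (p : Fin n → ℝ) (f : Fin n → ℝ → ℝ) (m : Mechanism)
    (σ : Profile n k) : Prop :=
  ∀ (x : Fin n) (τ : Strategy n k),
    expectedUtility p f m (Function.update σ x τ) (initialUrn n k) x ≤
      expectedUtility p f m σ (initialUrn n k) x

/-- The truthful vote of the owner of ball `i`: for the closer candidate. (A tie in distance is
resolved in favour of the candidate sampled earlier.) -/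
noncomputable def truthfulBallot {n k : ℕ} (p : Fin n → ℝ) (q : Situation n k) : Ballot := fun i =>
  decide (dist (p (q.owner i)) (p (q.owner (target i true))) ≤
    dist (p (q.owner i)) (p (q.owner (target i false))))

/-- Every participant always votes truthfully. -/
noncomputable def truthful {n k : ℕ} (p : Fin n → ℝ) : Profile n k :=
  fun _ q i => PMF.pure (truthfulBallot p q i)

/-- The owner of ball `i` is the one who wins a truthful vote. -/
def ShouldWin {n k : ℕ} (p : Fin n → ℝ) (q : Situation n k) (i : Fin 3) : Prop :=
  winner (truthfulBallot p q) = some i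

/-- The owner of ball `j` would (weakly) prefer a win of ball `i` to a three-way tie, i.e. to the
removal of the three balls, if everybody voted truthfully from then on. -/
def PrefersWin {n k : ℕ} (p : Fin n → ℝ) (f : Fin n → ℝ → ℝ) (q : Situation n k) (j i : Fin 3) :
    Prop :=
  expectedUtility p f Mechanism.remove (truthful p) (q.urn.remove q.sample) (q.owner j) ≤
    expectedUtility p f Mechanism.remove (truthful p) (q.urn.relabel q.sample (q.owner i))
      (q.owner j)

open Classical in
/-- The strategies for the mechanism that removes. A voter who should win looks at one of the two
candidates and votes for him if that candidate would prefer the voter's win to a three-way tie, and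
for the other candidate otherwise. Every other voter votes truthfully. The value of `order` tells
which of the two candidates is looked at first. -/
noncomputable def removeProfile {n k : ℕ} (p : Fin n → ℝ) (f : Fin n → ℝ → ℝ)
    (order : Fin n → Situation n k → Fin 3 → Bool) : Profile n k := fun x q i =>
  if ShouldWin p q i then
    if PrefersWin p f q (target i (order x q i)) i then PMF.pure (order x q i)
    else PMF.pure (!(order x q i))
  else PMF.pure (truthfulBallot p q i)

open Classical in
/-- The strategies for the mechanism that repeats the vote. A voter who should win casts an
arbitrary vote (prescribed by `first`) in the first round, and in the second round votes for the
candidate for whom he did not vote in the first round. Every other voter votes truthfully. -/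
noncomputable def repeatProfile {n k : ℕ} (p : Fin n → ℝ) (first : Profile n k) : Profile n k :=
  fun x q i =>
    if ShouldWin p q i then
      match q.ballots with
      | [] => first x q i
      | v :: _ => PMF.pure (!(v i))
    else PMF.pure (truthfulBallot p q i)

/-- Every vote among three distinct participants almost surely has the outcome of a truthful vote,
and the winner of the whole procedure has the same law as under truthful voting. -/
def IsQuasiTruthful {n k : ℕ} (p : Fin n → ℝ) (m : Mechanism) (σ : Profile n k) : Prop :=
  (∀ q : Situation n k, Function.Injective q.owner →
    ∀ v ∈ (ballotLaw σ q).support, winner v = winner (truthfulBallot p q)) ∧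
  ∀ w, winProb m σ (initialUrn n k) w = winProb m (truthful p) (initialUrn n k) w

/-- For some first sample of three balls with distinct labels, one of the owners votes, with
positive probability, for the strictly more distant candidate. -/
def HasUntruthfulOpening {n k : ℕ} (p : Fin n → ℝ) (σ : Profile n k) : Prop :=
  ∃ q : Situation n k, q.history = [] ∧ q.urn = initialUrn n k ∧ q.ballots = [] ∧
    Function.Injective q.owner ∧
    ∃ (i : Fin 3) (b : Bool), b ∈ (σ (q.owner i) q i).support ∧
      dist (p (q.owner i)) (p (q.owner (target i (!b)))) <
        dist (p (q.owner i)) (p (q.owner (target i b)))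

end TriadicConsensus

/-! In a triple on the line, each of the two outer participants is closer to the median than to the
other outer one. If both vote truthfully, the median wins whatever he votes himself. Both profiles
differ from truthful voting only in votes of the median (`LosersTruthful`), so all outcomes and the
law of the winner are the truthful ones, and a median cannot gain by deviating.

Under truthful voting every sample is relabelled with its median. For a set `S` of labels closed to
the left, let `a` of the `N` balls have labels in `S`. Then `a` is a birth-death chain that steps up
with probability 3a²(N-a)/N³ and down with probability 3a(N-a)²/N³. Its harmonic function with
values 0 and 1 at the ends is `lowProb N a`, the probability of fewer than `a` heads among `N - 1`
fair coins (`lowProb_harmonic`). Hence the law of the winner is explicit (`truthfulLaw`), and the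
expected payoff `truthfulValue` is a martingale under truthful voting. If, under some other profile,
no sample ever leads to a better urn than its truthful relabelling, this payoff is a
supermartingale, and the profile yields at most the truthful value (`sum_toReal_winProb_mul_le`).
The procedure terminates under every profile (`sum_winProb`). An equilibrium proof thus reduces to a
single sample.

There, an outer deviator can only make the opposite outer candidate win, which is worse for him than
the median (`truthfulValue_relabel_le`), or cause a tie, and the latter only if the median votes for
him. With repetition, the median switches his vote, so two ties in a row are impossible. With
removal, the median votes for somebody who does not profit from a tie. Such a candidate exists
(`truthfulValue_remove_le_or`): compared with removal, a win of the median pulls mass towards him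
from both sides, and according to the direction in which the mean moves, concavity favours one outer
candidate or the other (`sum_mul_utility_nonneg`). -/

namespace TriadicConsensus

open scoped ENNReal

/-! ### Expectations of nonnegative functions -/

/-- The expectation of a nonnegative function. -/
noncomputable def expect {α : Type*} (μ : PMF α) (g : α → ℝ≥0∞) : ℝ≥0∞ := ∑' a, μ a * g a

theorem expect_pure {α : Type*} (a : α) (g : α → ℝ≥0∞) : expect (PMF.pure a) g = g a := by
  unfold expect
  rw [tsum_eq_single a]
  · simp
  · intro b hb
    simp [hb]

theorem expect_bind {α β : Type*} (μ : PMF α) (ν : α → PMF β) (g : β → ℝ≥0∞) :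
    expect (μ.bind ν) g = expect μ fun a => expect (ν a) g := by
  unfold expect
  simp only [PMF.bind_apply, ← ENNReal.tsum_mul_right, ← ENNReal.tsum_mul_left, mul_assoc]
  exact ENNReal.tsum_comm

theorem expect_map {α β : Type*} (μ : PMF α) (φ : α → β) (g : β → ℝ≥0∞) :
    expect (μ.map φ) g = expect μ fun a => g (φ a) := by
  rw [PMF.map, expect_bind]
  simp [expect_pure]

theorem expect_mono {α : Type*} {μ : PMF α} {g g' : α → ℝ≥0∞}
    (h : ∀ a ∈ μ.support, g a ≤ g' a) : expect μ g ≤ expect μ g' := by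
  refine ENNReal.tsum_le_tsum fun a => ?_
  by_cases ha : a ∈ μ.support
  · exact mul_le_mul_right (h a ha) _
  · simp [(PMF.apply_eq_zero_iff μ a).mpr ha]

theorem expect_const {α : Type*} (μ : PMF α) (c : ℝ≥0∞) : expect μ (fun _ => c) = c := by
  rw [expect, ENNReal.tsum_mul_right, PMF.tsum_coe, one_mul]

theorem expect_add {α : Type*} (μ : PMF α) (g g' : α → ℝ≥0∞) :
    expect μ (fun a => g a + g' a) = expect μ g + expect μ g' := by
  simp only [expect, mul_add, ENNReal.tsum_add]

theorem expect_sum {α ι : Type*} (μ : PMF α) (t : Finset ι) (g : ι → α → ℝ≥0∞) :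
    expect μ (fun a => ∑ i ∈ t, g i a) = ∑ i ∈ t, expect μ (g i) := by
  simp only [expect, Finset.mul_sum]
  exact Summable.tsum_finsetSum fun _ _ => ENNReal.summable

theorem expect_mul_const {α : Type*} (μ : PMF α) (g : α → ℝ≥0∞) (c : ℝ≥0∞) :
    expect μ (fun a => g a * c) = expect μ g * c := by
  simp only [expect, ← mul_assoc, ENNReal.tsum_mul_right]

theorem expect_uniformOfFinset {α : Type*} (t : Finset α) (ht : t.Nonempty) (g : α → ℝ≥0∞) :
    expect (PMF.uniformOfFinset t ht) g = (∑ a ∈ t, g a) / t.card := by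
  classical
  unfold expect
  rw [tsum_eq_sum (s := t), ENNReal.div_eq_inv_mul, Finset.mul_sum]
  · exact Finset.sum_congr rfl fun a ha => by rw [PMF.uniformOfFinset_apply_of_mem ht ha]
  · intro a ha
    simp [PMF.uniformOfFinset_apply_of_notMem ht ha]

/-! ### One pass of the loop -/

variable {n k : ℕ}

open Classical in
/-- The law of one pass of the loop once the sample is known. -/
noncomputable def sampleLaw (m : Mechanism) (σ : Profile n k) (h : List (Event n k))
    (u : Urn n k) (s : Fin 3 → Ball n k) : PMF (Event n k) :=
  if Function.Injective (u.label ∘ s) then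
    (ballotLaw σ ⟨h, u, s, []⟩).bind fun v =>
      if winner v = none ∧ m = Mechanism.repeatThenRemove then
        (ballotLaw σ ⟨h, u, s, [v]⟩).map fun v' => ⟨s, [v, v']⟩
      else PMF.pure ⟨s, [v]⟩
  else PMF.pure ⟨s, []⟩

/-- The possible samples. -/
abbrev Urn.samples (u : Urn n k) : Finset (Fin 3 → Ball n k) :=
  Fintype.piFinset fun _ : Fin 3 => u.alive

theorem card_samples (u : Urn n k) : u.samples.card = u.alive.card ^ 3 := by
  simp [Urn.samples]

theorem expect_eventLaw (m : Mechanism) (σ : Profile n k) (h : List (Event n k))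
    (u : Urn n k) (hu : u.alive.Nonempty) (g : Event n k → ℝ≥0∞) :
    expect (eventLaw m σ h u hu) g =
      (∑ s ∈ u.samples, expect (sampleLaw m σ h u s) g) / u.samples.card := by
  rw [← expect_uniformOfFinset _ (Fintype.piFinset_nonempty.mpr fun _ => hu), ← expect_bind]
  rfl

theorem mem_support_ballotLaw {σ : Profile n k} {q : Situation n k} {v : Ballot}
    (hv : v ∈ (ballotLaw σ q).support) (i : Fin 3) : v i ∈ (σ (q.owner i) q i).support := by
  simp only [ballotLaw, PMF.mem_support_bind_iff, PMF.mem_support_map_iff] at hv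
  obtain ⟨a, ha, b, hb, c, hc, rfl⟩ := hv
  fin_cases i
  · exact ha
  · exact hb
  · exact hc

theorem mem_support_sampleLaw {m : Mechanism} {σ : Profile n k} {h : List (Event n k)}
    {u : Urn n k} {s : Fin 3 → Ball n k} {e : Event n k}
    (he : e ∈ (sampleLaw m σ h u s).support) :
    (¬ Function.Injective (u.label ∘ s) ∧ e = ⟨s, []⟩) ∨
    (Function.Injective (u.label ∘ s) ∧ ∃ v ∈ (ballotLaw σ ⟨h, u, s, []⟩).support,
      (¬ (winner v = none ∧ m = Mechanism.repeatThenRemove) ∧ e = ⟨s, [v]⟩) ∨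
      (winner v = none ∧ m = Mechanism.repeatThenRemove ∧
        ∃ v' ∈ (ballotLaw σ ⟨h, u, s, [v]⟩).support, e = ⟨s, [v, v']⟩)) := by
  classical
  unfold sampleLaw at he
  split_ifs at he with hi
  · rw [PMF.mem_support_bind_iff] at he
    obtain ⟨v, hv, he⟩ := he
    refine Or.inr ⟨hi, v, hv, ?_⟩
    split_ifs at he with hw
    · rw [PMF.mem_support_map_iff] at he
      obtain ⟨v', hv', rfl⟩ := he
      exact Or.inr ⟨hw.1, hw.2, v', hv', rfl⟩
    · rw [PMF.support_pure, Set.mem_singleton_iff] at he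
      exact Or.inl ⟨hw, he⟩
  · rw [PMF.support_pure, Set.mem_singleton_iff] at he
    exact Or.inl ⟨hi, he⟩

/-! ### The run of the procedure -/

open Classical in
theorem expect_runLaw_succ (m : Mechanism) (σ : Profile n k) (u₀ : Urn n k) (t : ℕ)
    (g : List (Event n k) × Urn n k → ℝ≥0∞) :
    expect (runLaw m σ u₀ (t + 1)) g = expect (runLaw m σ u₀ t) fun x =>
      if hx : x.2.Undecided then
        expect (eventLaw m σ x.1 x.2 hx.nonempty) fun e => g (e :: x.1, x.2.next e)
      else g x := by
  rw [runLaw, expect_bind]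
  congr 1
  funext x
  split_ifs
  · rw [expect_map]
  · rw [expect_pure]

/-- The supermartingale inequality, iterated. The hypothesis covers all histories because the
strategies may depend on them. -/
theorem expect_runLaw_le (m : Mechanism) (σ : Profile n k) (u₀ : Urn n k) (φ : Urn n k → ℝ≥0∞)
    (h : ∀ (l : List (Event n k)) (u : Urn n k) (hu : u.Undecided),
      expect (eventLaw m σ l u hu.nonempty) (fun e => φ (u.next e)) ≤ φ u) (t : ℕ) :
    expect (runLaw m σ u₀ t) (fun x => φ x.2) ≤ φ u₀ := by
  induction t with
  | zero => exact (expect_pure _ _).le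
  | succ t ih =>
    rw [expect_runLaw_succ]
    refine (expect_mono fun x _ => ?_).trans ih
    split_ifs with hx
    · exact h _ _ hx
    · exact le_rfl

theorem winProb_eq (m : Mechanism) (σ : Profile n k) (u₀ : Urn n k) (w : Fin n) :
    winProb m σ u₀ w = ⨆ t, expect (runLaw m σ u₀ t) fun x => report x.2 (some w) := rfl

theorem report_of_undecided {u : Urn n k} (hu : u.Undecided) (w : Fin n) :
    report u (some w) = 0 := by
  simp [report, hu]

/-- An undecided urn reports no participant and a decided urn is never changed again, so mass on a
participant only accumulates. Monotonicity lets suprema over `t` commute with finite sums over the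
participants. -/
theorem monotone_expect_report (m : Mechanism) (σ : Profile n k) (u₀ : Urn n k) (w : Fin n) :
    Monotone fun t => expect (runLaw m σ u₀ t) fun x => report x.2 (some w) := by
  refine monotone_nat_of_le_succ fun t => ?_
  rw [expect_runLaw_succ]
  refine expect_mono fun x _ => ?_
  split_ifs with hx
  · simp [report_of_undecided hx]
  · exact le_rfl

/-- A superharmonic function that dominates the expected payoff of the report bounds the expected
payoff of the procedure. -/
theorem sum_winProb_mul_le (m : Mechanism) (σ : Profile n k) (u₀ : Urn n k) (φ : Urn n k → ℝ≥0∞)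
    (c : Fin n → ℝ≥0∞)
    (h : ∀ (l : List (Event n k)) (u : Urn n k) (hu : u.Undecided),
      expect (eventLaw m σ l u hu.nonempty) (fun e => φ (u.next e)) ≤ φ u)
    (hr : ∀ u : Urn n k, ∑ w, report u (some w) * c w ≤ φ u) :
    ∑ w, winProb m σ u₀ w * c w ≤ φ u₀ := by
  simp only [winProb_eq, ENNReal.iSup_mul]
  rw [ENNReal.finsetSum_iSup_of_monotone
    fun w => (monotone_expect_report m σ u₀ w).mul_const (zero_le)]
  refine iSup_le fun t => ?_
  simp only [← expect_mul_const]
  rw [← expect_sum]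
  exact (expect_mono fun x _ => hr x.2).trans (expect_runLaw_le m σ u₀ φ h t)

/-! ### Termination -/

/-- The number of balls that carry the most frequent label. -/
def maxCount (u : Urn n k) : ℕ :=
  Finset.univ.sup fun l => (u.alive.filter fun b => u.label b = l).card

theorem card_alive_le (u : Urn n k) : u.alive.card ≤ n * k :=
  (Finset.card_le_univ _).trans (by simp)

theorem maxCount_le (u : Urn n k) : maxCount u ≤ n * k :=
  Finset.sup_le fun _ _ => (Finset.card_filter_le _ _).trans (card_alive_le u)

/-- Draw the same ball of a most frequent label twice and a ball of another label once. No vote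
takes place, so no strategy can prevent the growth, and drawing with replacement makes this work
even if the label has a single ball. -/
theorem exists_sample_maxCount {u : Urn n k} (hu : u.Undecided) :
    ∃ s ∈ u.samples, ¬ Function.Injective (u.label ∘ s) ∧
      maxCount u + 1 ≤ maxCount (u.next ⟨s, []⟩) := by
  obtain ⟨b₀, hb₀⟩ := hu.nonempty
  obtain ⟨l, -, hl⟩ := Finset.exists_mem_eq_sup Finset.univ ⟨u.label b₀, Finset.mem_univ _⟩
    fun l => (u.alive.filter fun b => u.label b = l).card
  have hpos : 0 < (u.alive.filter fun b => u.label b = l).card := by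
    rw [← hl]
    refine lt_of_lt_of_le ?_ (Finset.le_sup (Finset.mem_univ (u.label b₀)))
    exact Finset.card_pos.mpr ⟨b₀, by simp [hb₀]⟩
  obtain ⟨b, hb⟩ := Finset.card_pos.mp hpos
  rw [Finset.mem_filter] at hb
  obtain ⟨c, hc, hcl⟩ : ∃ c ∈ u.alive, u.label c ≠ l := by
    obtain ⟨a, ha, hal⟩ := Finset.exists_mem_ne hu l
    obtain ⟨c, hc, rfl⟩ := Finset.mem_image.mp ha
    exact ⟨c, hc, hal⟩
  have hinj : ¬ Function.Injective (u.label ∘ ![b, b, c]) := fun h => by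
    have := @h 0 1 (by simp)
    simp at this
  refine ⟨![b, b, c], ?_, hinj, ?_⟩
  · rw [Fintype.mem_piFinset]
    intro i
    fin_cases i
    · exact hb.1
    · exact hb.1
    · exact hc
  · have hnext : u.next ⟨![b, b, c], []⟩ = u.relabel ![b, b, c] l := by
      simp only [Urn.next, hinj, if_false]
      simp [majority, hb.2]
    rw [hnext]
    refine le_trans ?_ (Finset.le_sup (Finset.mem_univ l))
    have hsub : insert c (u.alive.filter fun b => u.label b = l) ⊆
        (u.relabel ![b, b, c] l).alive.filter fun b' => (u.relabel ![b, b, c] l).label b' = l := by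
      intro a ha
      rw [Finset.mem_insert, Finset.mem_filter] at ha
      rw [Finset.mem_filter]
      rcases ha with rfl | ha
      · refine ⟨hc, if_pos (Finset.mem_image.mpr ⟨2, Finset.mem_univ _, rfl⟩)⟩
      · refine ⟨ha.1, ?_⟩
        simp only [Urn.relabel]
        split_ifs
        · rfl
        · exact ha.2
    refine le_trans ?_ (Finset.card_le_card hsub)
    rw [Finset.card_insert_of_notMem (by simp [hcl])]
    exact Nat.add_le_add_right hl.le 1

/-- The potential that grows by at least one in expectation as long as the loop runs. -/
noncomputable def potential (u : Urn n k) : ℝ≥0∞ := ((2 * (n * k) ^ 3) ^ maxCount u : ℕ)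

/-- A sample that raises `maxCount` has probability at least 1/(nk)³. With base C = 2(nk)³, this
sample alone contributes at least C^(maxCount+1)/(nk)³ = 2·C^maxCount to the expectation. -/
theorem potential_add_one_le (m : Mechanism) (σ : Profile n k) (l : List (Event n k))
    (u : Urn n k) (hu : u.Undecided) :
    potential u + 1 ≤ expect (eventLaw m σ l u hu.nonempty) fun e => potential (u.next e) := by
  obtain ⟨s, hs, hinj, hmax⟩ := exists_sample_maxCount hu
  have hcard : 0 < u.samples.card := Finset.card_pos.mpr ⟨s, hs⟩
  rw [expect_eventLaw, ENNReal.le_div_iff_mul_le (Or.inl (by exact_mod_cast hcard.ne'))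
    (Or.inl (ENNReal.natCast_ne_top _))]
  refine le_trans ?_ (Finset.single_le_sum
    (f := fun s => expect (sampleLaw m σ l u s) fun e => potential (u.next e))
    (fun _ _ => zero_le) hs)
  have hN : 0 < n * k := (Finset.card_pos.mpr hu.nonempty).trans_le (card_alive_le u)
  simp only [sampleLaw, hinj, if_false, expect_pure, potential]
  norm_cast
  have hC : 1 ≤ 2 * (n * k) ^ 3 := by have := Nat.pow_pos (n := 3) hN; omega
  calc ((2 * (n * k) ^ 3) ^ maxCount u + 1) * u.samples.card
      ≤ ((2 * (n * k) ^ 3) ^ maxCount u + (2 * (n * k) ^ 3) ^ maxCount u) * (n * k) ^ 3 := by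
        refine Nat.mul_le_mul (Nat.add_le_add_left (Nat.one_le_pow _ _ hC) _) ?_
        rw [card_samples]
        exact Nat.pow_le_pow_left (card_alive_le u) 3
    _ = (2 * (n * k) ^ 3) ^ (maxCount u + 1) := by ring
    _ ≤ _ := Nat.pow_le_pow_right hC hmax

/-- The probability that the loop has not ended after `t` passes. -/
noncomputable def undecidedProb (m : Mechanism) (σ : Profile n k) (u₀ : Urn n k) (t : ℕ) : ℝ≥0∞ :=
  expect (runLaw m σ u₀ t) fun x => if x.2.Undecided then 1 else 0

theorem antitone_undecidedProb (m : Mechanism) (σ : Profile n k) (u₀ : Urn n k) :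
    Antitone (undecidedProb m σ u₀) := by
  refine antitone_nat_of_succ_le fun t => ?_
  rw [undecidedProb, expect_runLaw_succ]
  refine expect_mono fun x _ => ?_
  split_ifs with hx
  · refine (expect_mono (g' := fun _ => 1) fun e _ => ?_).trans (expect_const _ _).le
    dsimp only
    split_ifs <;> simp
  · exact le_rfl

theorem sum_undecidedProb_le (m : Mechanism) (σ : Profile n k) (u₀ : Urn n k) (t : ℕ) :
    ∑ i ∈ Finset.range t, undecidedProb m σ u₀ i ≤
      expect (runLaw m σ u₀ t) fun x => potential x.2 := by
  induction t with
  | zero => simp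
  | succ t ih =>
    rw [Finset.sum_range_succ, expect_runLaw_succ]
    refine (add_le_add_left ih _).trans ?_
    rw [undecidedProb, ← expect_add]
    refine expect_mono fun x _ => ?_
    split_ifs with hx
    · exact potential_add_one_le m σ x.1 x.2 hx
    · simp

/-- The undecided probabilities decrease and their sum is at most the bounded expected potential, so
they are O(1/t). -/
theorem mul_undecidedProb_le (m : Mechanism) (σ : Profile n k) (u₀ : Urn n k) (t : ℕ) :
    t * undecidedProb m σ u₀ t ≤ ((2 * (n * k) ^ 3) ^ (n * k) + 1 : ℕ) := by
  calc t * undecidedProb m σ u₀ t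
      = ∑ i ∈ Finset.range t, undecidedProb m σ u₀ t := by simp
    _ ≤ ∑ i ∈ Finset.range t, undecidedProb m σ u₀ i :=
        Finset.sum_le_sum fun i hi =>
          antitone_undecidedProb m σ u₀ (Finset.mem_range.mp hi).le
    _ ≤ _ := sum_undecidedProb_le m σ u₀ t
    _ ≤ expect (runLaw m σ u₀ t) fun _ => ((2 * (n * k) ^ 3) ^ (n * k) + 1 : ℕ) := by
        refine expect_mono fun x _ => ?_
        simp only [potential]
        norm_cast
        -- With base 0 powers are not monotone in the exponent; the added 1 in the bound covers this
        -- case.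
        rcases Nat.eq_zero_or_pos (2 * (n * k) ^ 3) with h0 | h0
        · rw [h0]
          exact (pow_le_one₀ (Nat.zero_le 0) (Nat.zero_le 1)).trans (Nat.le_add_left _ _)
        · exact (Nat.pow_le_pow_right h0 (maxCount_le _)).trans (Nat.le_succ _)
    _ = _ := expect_const _ _

/-- There is a ball that can be reported. -/
def Urn.Proper (u : Urn n k) : Prop := u.alive.Nonempty ∨ u.removed.Nonempty

theorem Urn.proper_relabel {u : Urn n k} (hu : u.Proper) (s : Fin 3 → Ball n k) (w : Fin n) :
    (u.relabel s w).Proper := hu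

theorem Urn.proper_remove (u : Urn n k) (s : Fin 3 → Ball n k) : (u.remove s).Proper :=
  Or.inr ⟨s 0, Finset.mem_image_of_mem s (Finset.mem_univ 0)⟩

theorem Urn.proper_next {u : Urn n k} (hu : u.Proper) (e : Event n k) : (u.next e).Proper := by
  unfold Urn.next
  split
  · split
    · exact Urn.proper_relabel hu _ _
    · exact Urn.proper_remove u _
  · exact Urn.proper_relabel hu _ _

theorem proper_of_mem_support_runLaw {m : Mechanism} {σ : Profile n k} {u₀ : Urn n k}
    (hu₀ : u₀.Proper) (t : ℕ) : ∀ x ∈ (runLaw m σ u₀ t).support, x.2.Proper := by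
  induction t with
  | zero =>
    intro x hx
    rw [runLaw, PMF.support_pure, Set.mem_singleton_iff] at hx
    rwa [hx]
  | succ t ih =>
    intro x hx
    rw [runLaw, PMF.mem_support_bind_iff] at hx
    obtain ⟨y, hy, hx⟩ := hx
    split_ifs at hx
    · rw [PMF.mem_support_map_iff] at hx
      obtain ⟨e, -, rfl⟩ := hx
      exact Urn.proper_next (ih y hy) e
    · rw [PMF.support_pure, Set.mem_singleton_iff] at hx
      rw [hx]
      exact ih y hy

theorem sum_report {u : Urn n k} (hu : u.Proper) :
    ∑ w, report u (some w) + (if u.Undecided then 1 else 0) = 1 := by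
  have htot : report u none + ∑ w, report u (some w) = 1 := by
    rw [← Fintype.sum_option, ← tsum_fintype (L := .unconditional _)]
    exact PMF.tsum_coe _
  have hnone : report u none = if u.Undecided then 1 else 0 := by
    unfold report
    split_ifs with h1 h2 h3
    · simp
    · rw [PMF.apply_eq_zero_iff]
      simp [PMF.support_map]
    · rw [PMF.apply_eq_zero_iff]
      simp [PMF.support_map]
    · exact absurd hu (by simp [Urn.Proper, h2, h3])
  rw [← hnone, add_comm, htot]

/-- The procedure returns a winner with probability one. -/
theorem sum_winProb (m : Mechanism) (σ : Profile n k) {u₀ : Urn n k} (hu₀ : u₀.Proper) :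
    ∑ w, winProb m σ u₀ w = 1 := by
  have hsum : ∀ t, (∑ w, expect (runLaw m σ u₀ t) fun x => report x.2 (some w)) +
      undecidedProb m σ u₀ t = 1 := by
    intro t
    rw [← expect_sum, undecidedProb, ← expect_add]
    refine le_antisymm ?_ ?_
    · exact (expect_mono (g' := fun _ => 1) fun x hx =>
        (sum_report (proper_of_mem_support_runLaw hu₀ t x hx)).le).trans (expect_const _ _).le
    · exact (expect_const (runLaw m σ u₀ t) 1).ge.trans (expect_mono fun x hx =>
        (sum_report (proper_of_mem_support_runLaw hu₀ t x hx)).ge)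
  refine le_antisymm ?_ ?_
  · simp only [winProb_eq]
    rw [ENNReal.finsetSum_iSup_of_monotone fun w => monotone_expect_report m σ u₀ w]
    exact iSup_le fun t => le_self_add.trans (hsum t).le
  -- The undecided mass after `t` passes is at most a constant over `t`, so the total winning
  -- probability plus this error is at least 1 for all `t ≥ 1`; then `t` tends to infinity.
  · have hlim : Filter.Tendsto (fun t : ℕ => (∑ w, winProb m σ u₀ w) +
        ((2 * (n * k) ^ 3) ^ (n * k) + 1 : ℕ) / (t : ℝ≥0∞)) Filter.atTop
        (nhds ((∑ w, winProb m σ u₀ w) + 0)) :=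
      tendsto_const_nhds.add
        (ENNReal.Tendsto.const_div ENNReal.tendsto_nat_nhds_top (Or.inr (ENNReal.natCast_ne_top _))
          |>.trans (by simp))
    rw [add_zero] at hlim
    refine ge_of_tendsto hlim (Filter.eventually_atTop.mpr ⟨1, fun t ht => ?_⟩)
    rw [← hsum t]
    refine add_le_add (Finset.sum_le_sum fun w _ => ?_) ?_
    · rw [winProb_eq]
      exact le_iSup (fun t => expect (runLaw m σ u₀ t) fun x => report x.2 (some w)) t
    · rw [ENNReal.le_div_iff_mul_le (Or.inl (by exact_mod_cast (by omega : t ≠ 0)))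
        (Or.inl (ENNReal.natCast_ne_top _)), mul_comm]
      exact mul_undecidedProb_le m σ u₀ t

/-! ### The law of the winner under truthful voting -/

/-- The probability that the final winner is one of the low labels, if `a` of the `N` balls have
low labels and every sample is relabelled with its median. -/
noncomputable def lowProb (N a : ℕ) : ℝ :=
  (∑ j ∈ Finset.range a, ((N - 1).choose j : ℝ)) / 2 ^ (N - 1)

theorem lowProb_zero (N : ℕ) : lowProb N 0 = 0 := by simp [lowProb]

theorem lowProb_self {N : ℕ} (hN : 0 < N) : lowProb N N = 1 := by
  obtain ⟨M, rfl⟩ := Nat.exists_eq_add_of_lt hN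
  simp only [lowProb, zero_add, Nat.add_sub_cancel]
  rw [div_eq_one_iff_eq (by positivity)]
  exact_mod_cast Nat.sum_range_choose M

theorem lowProb_mono (N : ℕ) : Monotone (lowProb N) := fun a b hab => by
  unfold lowProb
  gcongr

/-- Pascal's rule, summed. In terms of coins, conditioning on one of them makes `lowProb (N + 1) (a
+ 1)` the average of `lowProb N (a + 1)` and `lowProb N a`, and both comparisons below follow from
that. -/
theorem sum_range_choose_succ (M a : ℕ) :
    ∑ j ∈ Finset.range (a + 1), ((M + 1).choose j : ℝ) =
      ∑ j ∈ Finset.range (a + 1), (M.choose j : ℝ) + ∑ j ∈ Finset.range a, (M.choose j : ℝ) := by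
  rw [Finset.sum_range_succ', Finset.sum_range_succ' (fun j => (M.choose j : ℝ))]
  simp only [Nat.choose_succ_succ, Nat.cast_add, Finset.sum_add_distrib, Nat.choose_zero_right]
  ring

theorem lowProb_succ_le {N : ℕ} (hN : 0 < N) (a : ℕ) : lowProb (N + 1) a ≤ lowProb N a := by
  obtain ⟨M, rfl⟩ := Nat.exists_eq_add_of_lt hN
  cases a with
  | zero => simp [lowProb_zero]
  | succ a =>
    simp only [lowProb, zero_add, Nat.add_sub_cancel]
    rw [div_le_div_iff₀ (by positivity) (by positivity), sum_range_choose_succ, pow_succ]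
    have : ∑ j ∈ Finset.range a, (M.choose j : ℝ) ≤ ∑ j ∈ Finset.range (a + 1), (M.choose j : ℝ) := by
      gcongr
      omega
    have h2 : (0 : ℝ) < 2 ^ M := by positivity
    nlinarith

theorem lowProb_le_succ_succ {N : ℕ} (hN : 0 < N) (a : ℕ) :
    lowProb N a ≤ lowProb (N + 1) (a + 1) := by
  obtain ⟨M, rfl⟩ := Nat.exists_eq_add_of_lt hN
  simp only [lowProb, zero_add, Nat.add_sub_cancel]
  rw [div_le_div_iff₀ (by positivity) (by positivity), sum_range_choose_succ, pow_succ]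
  have : ∑ j ∈ Finset.range a, (M.choose j : ℝ) ≤ ∑ j ∈ Finset.range (a + 1), (M.choose j : ℝ) := by
    gcongr
    omega
  have h2 : (0 : ℝ) < 2 ^ M := by positivity
  nlinarith

theorem lowProb_add_le {N : ℕ} (hN : 0 < N) (r a : ℕ) : lowProb (N + r) a ≤ lowProb N a := by
  induction r with
  | zero => exact le_rfl
  | succ r ih => exact (lowProb_succ_le (N := N + r) (by omega) a).trans ih

theorem lowProb_le_add_add {N : ℕ} (hN : 0 < N) (r a : ℕ) :
    lowProb N a ≤ lowProb (N + r) (a + r) := by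
  induction r with
  | zero => exact le_rfl
  | succ r ih => exact ih.trans (lowProb_le_succ_succ (N := N + r) (by omega) (a + r))

/-- Up to a common factor, the coefficients are the probabilities that a sample has exactly two,
respectively exactly one, low balls. The increments are binomial coefficients, and the identity is
C(M,b+1)(b+1) = C(M,b)(M-b) for N = M+1 and a = b+1. At `a = 0` both sides vanish, so the truncated
`a - 1` is harmless. -/
theorem lowProb_harmonic {N a : ℕ} (ha : a ≤ N) :
    ((a : ℝ) ^ 2 * (N - a)) * (lowProb N (a + 1) - lowProb N a) =
      (a * (N - a) ^ 2) * (lowProb N a - lowProb N (a - 1)) := by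
  rcases a with _ | b
  · simp
  obtain ⟨M, rfl⟩ : ∃ M, N = M + 1 := ⟨N - 1, by omega⟩
  have hb : b ≤ M := by omega
  have hc : (M.choose (b + 1) : ℝ) * (b + 1) = M.choose b * (M - b) := by
    rw [← Nat.cast_sub hb]
    exact_mod_cast Nat.choose_succ_right_eq M b
  simp only [lowProb, Nat.add_sub_cancel]
  rw [← sub_div, ← sub_div, Finset.sum_range_succ _ (b + 1), Finset.sum_range_succ _ b]
  push_cast
  linear_combination ((b : ℝ) + 1) * (M - b) / 2 ^ M * hc

/-- The number of balls whose label lies in `S`. -/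
def countIn (u : Urn n k) (S : Finset (Fin n)) : ℕ := (u.alive.filter fun b => u.label b ∈ S).card

theorem countIn_le (u : Urn n k) (S : Finset (Fin n)) : countIn u S ≤ u.alive.card :=
  Finset.card_filter_le _ _

theorem countIn_empty (u : Urn n k) : countIn u ∅ = 0 := by simp [countIn]

theorem countIn_univ (u : Urn n k) : countIn u Finset.univ = u.alive.card := by simp [countIn]

theorem countIn_mono (u : Urn n k) {S T : Finset (Fin n)} (h : S ⊆ T) : countIn u S ≤ countIn u T :=
  Finset.card_le_card fun _ hb =>
    Finset.mem_filter.mpr ⟨(Finset.mem_filter.mp hb).1, h (Finset.mem_filter.mp hb).2⟩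

/-- With every participant, `S` contains all those further left. -/
def IsLeftClosed (p : Fin n → ℝ) (S : Finset (Fin n)) : Prop := ∀ a b, p a ≤ p b → b ∈ S → a ∈ S

/-- The participants not to the right of `w`. -/
noncomputable def upTo (p : Fin n → ℝ) (w : Fin n) : Finset (Fin n) :=
  Finset.univ.filter fun v => p v ≤ p w

/-- The participants to the left of `w`. -/
noncomputable def leftOf (p : Fin n → ℝ) (w : Fin n) : Finset (Fin n) :=
  Finset.univ.filter fun v => p v < p w

theorem isLeftClosed_upTo (p : Fin n → ℝ) (w : Fin n) : IsLeftClosed p (upTo p w) :=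
  fun a b hab hb => by
    simp only [upTo, Finset.mem_filter, Finset.mem_univ, true_and] at hb ⊢
    exact hab.trans hb

theorem isLeftClosed_leftOf (p : Fin n → ℝ) (w : Fin n) : IsLeftClosed p (leftOf p w) :=
  fun a b hab hb => by
    simp only [leftOf, Finset.mem_filter, Finset.mem_univ, true_and] at hb ⊢
    exact hab.trans_lt hb

theorem leftOf_subset_upTo (p : Fin n → ℝ) (w : Fin n) : leftOf p w ⊆ upTo p w := fun v hv => by
  simp only [leftOf, upTo, Finset.mem_filter, Finset.mem_univ, true_and] at hv ⊢
  exact hv.le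

/-- The sum telescopes: for the rightmost `a` of a left-closed set, `upTo p a` is the whole set and
`leftOf p a` is the set without `a`. -/
theorem sum_upTo_sub_leftOf {p : Fin n → ℝ} (hp : Function.Injective p)
    (F : Finset (Fin n) → ℝ) (S : Finset (Fin n)) (hS : IsLeftClosed p S) :
    ∑ w ∈ S, (F (upTo p w) - F (leftOf p w)) = F S - F ∅ := by
  induction S using Finset.induction_on_max_value p with
  | empty => simp
  | insert a S ha hmax ih =>
    have h1 : upTo p a = insert a S := by
      ext v
      simp only [upTo, Finset.mem_filter, Finset.mem_univ, true_and]
      refine ⟨fun h => hS v a h (Finset.mem_insert_self a S), fun h => ?_⟩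
      rcases Finset.mem_insert.mp h with rfl | h
      · exact le_rfl
      · exact hmax v h
    have h2 : leftOf p a = S := by
      ext v
      simp only [leftOf, Finset.mem_filter, Finset.mem_univ, true_and]
      constructor
      · intro h
        rcases Finset.mem_insert.mp (hS v a h.le (Finset.mem_insert_self a S)) with rfl | h'
        · exact absurd h (lt_irrefl _)
        · exact h'
      · intro h
        exact lt_of_le_of_ne (hmax v h) fun h' => ha (hp h' ▸ h)
    rw [Finset.sum_insert ha, h1, h2, ih fun x y hxy hy => ?_]
    · ring
    · rw [← h2] at hy ⊢
      exact isLeftClosed_leftOf p a x y hxy hy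

/-- The law of the winner, for a given urn, if everybody votes truthfully. -/
noncomputable def truthfulLaw (p : Fin n → ℝ) (u : Urn n k) (w : Fin n) : ℝ :=
  if u.alive.Nonempty then
    lowProb u.alive.card (countIn u (upTo p w)) - lowProb u.alive.card (countIn u (leftOf p w))
  else (u.removed.filter fun b => u.label b = w).card / u.removed.card

theorem truthfulLaw_nonneg (p : Fin n → ℝ) (u : Urn n k) (w : Fin n) : 0 ≤ truthfulLaw p u w := by
  unfold truthfulLaw
  split_ifs
  · exact sub_nonneg.mpr (lowProb_mono _ (countIn_mono u (leftOf_subset_upTo p w)))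
  · positivity

theorem sum_truthfulLaw_of_isLeftClosed {p : Fin n → ℝ} (hp : Function.Injective p)
    {u : Urn n k} (hu : u.alive.Nonempty) {S : Finset (Fin n)} (hS : IsLeftClosed p S) :
    ∑ w ∈ S, truthfulLaw p u w = lowProb u.alive.card (countIn u S) := by
  simp only [truthfulLaw, hu, if_true]
  rw [sum_upTo_sub_leftOf hp (fun S => lowProb u.alive.card (countIn u S)) S hS, countIn_empty,
    lowProb_zero, sub_zero]

theorem sum_truthfulLaw {p : Fin n → ℝ} (hp : Function.Injective p) {u : Urn n k}
    (hu : u.Proper) : ∑ w, truthfulLaw p u w = 1 := by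
  by_cases ha : u.alive.Nonempty
  · rw [sum_truthfulLaw_of_isLeftClosed hp ha fun _ _ _ _ => Finset.mem_univ _, countIn_univ,
      lowProb_self (Finset.card_pos.mpr ha)]
  · have hr : u.removed.Nonempty := hu.resolve_left ha
    simp only [truthfulLaw, ha, if_false]
    rw [← Finset.sum_div, div_eq_one_iff_eq (by exact_mod_cast (Finset.card_pos.mpr hr).ne')]
    exact_mod_cast (Finset.card_eq_sum_card_fiberwise fun b _ => Finset.mem_univ (u.label b)).symm

theorem uniformOfFinset_map_some {α β : Type*} [DecidableEq α] [DecidableEq β] (t : Finset α)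
    (ht : t.Nonempty) (g : α → β) (w : β) :
    ((PMF.uniformOfFinset t ht).map fun b => some (g b)) (some w) =
      ENNReal.ofReal ((t.filter fun b => g b = w).card / t.card) := by
  have hc : (0 : ℝ) < t.card := by exact_mod_cast Finset.card_pos.mpr ht
  rw [PMF.map_apply, ENNReal.ofReal_div_of_pos hc, ENNReal.ofReal_natCast, ENNReal.ofReal_natCast,
    tsum_eq_sum (s := t)]
  · rw [ENNReal.div_eq_inv_mul, mul_comm, ← nsmul_eq_mul, ← Finset.sum_const, Finset.sum_filter]
    refine Finset.sum_congr rfl fun a ha => ?_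
    simp [PMF.uniformOfFinset_apply_of_mem ht ha, eq_comm]
  · intro a ha
    simp [PMF.uniformOfFinset_apply_of_notMem ht ha]

/-- The boundary condition of the martingale. With a single label left every count is 0 or `N`,
where `lowProb` is 0 or 1, and the difference of the two counts picks out that label. -/
theorem report_eq_truthfulLaw {p : Fin n → ℝ} (hp : Function.Injective p) {u : Urn n k}
    (hu : ¬ u.Undecided) (w : Fin n) :
    report u (some w) = ENNReal.ofReal (truthfulLaw p u w) := by
  classical
  unfold report truthfulLaw
  rw [if_neg hu]
  split_ifs with ha hr
  · rw [uniformOfFinset_map_some]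
    obtain ⟨b₀, hb₀⟩ := ha
    have hlab : ∀ b ∈ u.alive, u.label b = u.label b₀ := fun b hb =>
      Finset.card_le_one.mp (not_lt.mp hu) _ (Finset.mem_image_of_mem _ hb) _
        (Finset.mem_image_of_mem _ hb₀)
    have hcount : ∀ P : Fin n → Prop, [DecidablePred P] →
        (u.alive.filter fun b => P (u.label b)).card =
          if P (u.label b₀) then u.alive.card else 0 := by
      intro P _
      split_ifs with h
      · rw [Finset.filter_true_of_mem fun b hb => by rwa [hlab b hb]]
      · rw [Finset.filter_false_of_mem fun b hb => by rwa [hlab b hb], Finset.card_empty]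
    have hN : 0 < u.alive.card := Finset.card_pos.mpr ⟨b₀, hb₀⟩
    have hN' : (u.alive.card : ℝ) ≠ 0 := by exact_mod_cast hN.ne'
    congr 1
    rw [hcount fun l => l = w]
    unfold countIn
    rw [hcount fun l => l ∈ upTo p w, hcount fun l => l ∈ leftOf p w]
    simp only [upTo, leftOf, Finset.mem_filter, Finset.mem_univ, true_and]
    rcases lt_trichotomy (p (u.label b₀)) (p w) with h | h | h
    · have : u.label b₀ ≠ w := fun h' => by rw [h'] at h; exact lt_irrefl _ h
      simp [h, h.le, this]
    · have : u.label b₀ = w := hp h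
      simp [this, lowProb_self hN, lowProb_zero, hN']
    · have : u.label b₀ ≠ w := fun h' => by rw [h'] at h; exact lt_irrefl _ h
      simp [h.not_ge, h.le.not_gt, this]
  · rw [uniformOfFinset_map_some]
  -- With nothing removed either, both sides are 0; the right one is 0/0.
  · rw [Finset.not_nonempty_iff_eq_empty.mp hr]
    simp

/-! ### One truthful pass of the loop -/

/-- The urn after a sample on which everybody votes truthfully. -/
noncomputable def truthfulNext (p : Fin n → ℝ) (u : Urn n k) (s : Fin 3 → Ball n k) : Urn n k :=
  u.next ⟨s, [truthfulBallot p ⟨[], u, s, []⟩]⟩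

theorem exists_lt_lt {P : Fin 3 → ℝ} (hP : Function.Injective P) :
    ∃ a m c, P a < P m ∧ P m < P c := by
  have h01 : P 0 ≠ P 1 := fun h => by simpa using hP h
  have h02 : P 0 ≠ P 2 := fun h => by simpa using hP h
  have h12 : P 1 ≠ P 2 := fun h => by simpa using hP h
  rcases h01.lt_or_gt with h | h <;> rcases h02.lt_or_gt with h' | h' <;>
    rcases h12.lt_or_gt with h'' | h''
  · exact ⟨0, 1, 2, h, h''⟩
  · exact ⟨0, 2, 1, h', h''⟩
  · exact absurd (h.trans h'') h'.le.not_gt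
  · exact ⟨2, 0, 1, h', h⟩
  · exact ⟨1, 0, 2, h, h'⟩
  · exact absurd (h''.trans h) h'.le.not_gt
  · exact ⟨1, 2, 0, h'', h'⟩
  · exact ⟨2, 1, 0, h'', h⟩

theorem winner_eq_some {v : Ballot} {m : Fin 3} (h : ∀ j, j ≠ m → target j (v j) = m) :
    winner v = some m := by
  revert v m
  decide

theorem target_eq_or {a m : Fin 3} (h : a ≠ m) :
    ∃ b, target a b = m ∧ target a (!b) ≠ m ∧ target a (!b) ≠ a := by
  revert a m
  decide

theorem truthfulBallot_eq {p : Fin n → ℝ} {q : Situation n k} {a m : Fin 3} (ham : a ≠ m)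
    (h : ∀ c, c ≠ a → c ≠ m →
      dist (p (q.owner a)) (p (q.owner m)) < dist (p (q.owner a)) (p (q.owner c))) :
    target a (truthfulBallot p q a) = m := by
  obtain ⟨b, hb, hb', hb''⟩ := target_eq_or ham
  have hlt := h _ hb'' hb'
  cases b with
  | true =>
    rw [truthfulBallot, decide_eq_true]
    · exact hb
    · rw [hb]
      exact hlt.le
  | false =>
    rw [truthfulBallot, decide_eq_false]
    · exact hb
    · rw [hb]
      exact not_le.mpr hlt

theorem eq_of_ne_of_ne {a m c i : Fin 3} (ham : a ≠ m) (hmc : m ≠ c) (hac : a ≠ c) (hia : i ≠ a)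
    (him : i ≠ m) : i = c := by
  omega

/-- Those who are not the median vote for the median if they vote truthfully. -/
theorem target_truthfulBallot {p : Fin n → ℝ} {q : Situation n k} {a m c : Fin 3}
    (h₁ : p (q.owner a) < p (q.owner m)) (h₂ : p (q.owner m) < p (q.owner c)) (j : Fin 3)
    (hj : j ≠ m) : target j (truthfulBallot p q j) = m := by
  have ham : a ≠ m := by rintro rfl; exact lt_irrefl _ h₁
  have hmc : m ≠ c := by rintro rfl; exact lt_irrefl _ h₂
  have hac : a ≠ c := by rintro rfl; exact lt_asymm h₁ h₂
  refine truthfulBallot_eq hj fun i hij him => ?_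
  by_cases hja : j = a
  · subst hja
    rw [eq_of_ne_of_ne ham hmc hac hij him, Real.dist_eq, Real.dist_eq, abs_of_neg (by linarith),
      abs_of_neg (by linarith)]
    linarith
  · have hjc := eq_of_ne_of_ne ham hmc hac hja hj
    subst hjc
    rw [eq_of_ne_of_ne hmc.symm ham.symm hac.symm hij him, Real.dist_eq, Real.dist_eq,
      abs_of_pos (by linarith), abs_of_pos (by linarith)]
    linarith

theorem winner_truthfulBallot {p : Fin n → ℝ} {q : Situation n k} {a m c : Fin 3}
    (h₁ : p (q.owner a) < p (q.owner m)) (h₂ : p (q.owner m) < p (q.owner c)) :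
    winner (truthfulBallot p q) = some m :=
  winner_eq_some (target_truthfulBallot h₁ h₂)

theorem truthfulNext_eq_relabel {p : Fin n → ℝ} {u : Urn n k}
    {s : Fin 3 → Ball n k} {a m c : Fin 3} (hinj : Function.Injective (u.label ∘ s))
    (h₁ : p (u.label (s a)) < p (u.label (s m))) (h₂ : p (u.label (s m)) < p (u.label (s c))) :
    truthfulNext p u s = u.relabel s (u.label (s m)) := by
  have := winner_truthfulBallot (p := p) (q := ⟨[], u, s, []⟩) h₁ h₂
  simp only [truthfulNext, Urn.next, hinj, if_true, List.findSome?, this]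

/-- The sample is relabelled with its median. -/
theorem exists_truthfulNext_eq {p : Fin n → ℝ} (hp : Function.Injective p) (u : Urn n k)
    (s : Fin 3 → Ball n k) :
    ∃ w, truthfulNext p u s = u.relabel s w ∧ ∀ S, IsLeftClosed p S →
      (w ∈ S ↔ ∃ i j, i ≠ j ∧ u.label (s i) ∈ S ∧ u.label (s j) ∈ S) := by
  by_cases hinj : Function.Injective (u.label ∘ s)
  · obtain ⟨a, m, c, h₁, h₂⟩ := exists_lt_lt (hp.comp hinj)
    simp only [Function.comp_apply] at h₁ h₂
    have ham : a ≠ m := by rintro rfl; exact lt_irrefl _ h₁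
    have hmc : m ≠ c := by rintro rfl; exact lt_irrefl _ h₂
    have hac : a ≠ c := by rintro rfl; exact lt_asymm h₁ h₂
    refine ⟨_, truthfulNext_eq_relabel hinj h₁ h₂, fun S hS => ⟨fun h => ?_, ?_⟩⟩
    · exact ⟨a, m, ham, hS _ _ h₁.le h, h⟩
    · rintro ⟨i, j, hij, hi, hj⟩
      have key : ∀ i, i ≠ a → u.label (s i) ∈ S → u.label (s m) ∈ S := fun i hia hi => by
        by_cases him : i = m
        · exact him ▸ hi
        · rw [eq_of_ne_of_ne ham hmc hac hia him] at hi
          exact hS _ _ h₂.le hi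
      by_cases hia : i = a
      · exact key j (fun h => hij (hia.trans h.symm)) hj
      · exact key i hia hi
  · refine ⟨majority (u.label ∘ s), by simp only [truthfulNext, Urn.next, hinj, if_false],
      fun S _ => ?_⟩
    obtain ⟨i, j, hij, hi, hj⟩ : ∃ i j, i ≠ j ∧ u.label (s i) = majority (u.label ∘ s) ∧
        u.label (s j) = majority (u.label ∘ s) := by
      simp only [majority, Function.comp_apply]
      split_ifs with h
      · rcases h with h | h
        · exact ⟨0, 1, by decide, rfl, h.symm⟩
        · exact ⟨0, 2, by decide, rfl, h.symm⟩
      · refine ⟨1, 2, by decide, rfl, ?_⟩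
        by_contra h12
        refine hinj fun i j hij => ?_
        push Not at h
        fin_cases i <;> fin_cases j <;> simp_all [eq_comm]
    rw [← hi]
    refine ⟨fun h => ⟨i, j, hij, h, ?_⟩, ?_⟩
    · rwa [hj, ← hi]
    · rintro ⟨i', j', hij', hi', hj'⟩
      -- Two pairs out of three indices always meet, so a pair with labels in `S` contains a ball of
      -- the majority label.
      have : i' = i ∨ i' = j ∨ j' = i ∨ j' = j := by
        revert hij hij'
        clear * -
        revert i j i' j'
        decide
      rcases this with rfl | rfl | rfl | rfl
      · exact hi'
      · rwa [hi, ← hj]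
      · exact hj'
      · rwa [hi, ← hj]

theorem alive_truthfulNext {p : Fin n → ℝ} (hp : Function.Injective p) (u : Urn n k)
    (s : Fin 3 → Ball n k) : (truthfulNext p u s).alive = u.alive := by
  obtain ⟨w, hw, -⟩ := exists_truthfulNext_eq hp u s
  rw [hw]
  rfl

theorem sum_samples_mul (u : Urn n k) (f₀ f₁ f₂ : Ball n k → ℝ) :
    ∑ s ∈ u.samples, f₀ (s 0) * f₁ (s 1) * f₂ (s 2) =
      (∑ b ∈ u.alive, f₀ b) * (∑ b ∈ u.alive, f₁ b) * ∑ b ∈ u.alive, f₂ b := by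
  have := (Finset.prod_univ_sum (fun _ : Fin 3 => u.alive) ![f₀, f₁, f₂]).symm
  simpa [Fin.prod_univ_three] using this

theorem countIn_relabel (u : Urn n k) {s : Fin 3 → Ball n k} (hs : s ∈ u.samples) (w : Fin n)
    (S : Finset (Fin n)) :
    countIn (u.relabel s w) S =
      if w ∈ S then ((u.alive.filter fun b => u.label b ∈ S) ∪ {s 0, s 1, s 2}).card
      else ((u.alive.filter fun b => u.label b ∈ S) \ {s 0, s 1, s 2}).card := by
  have him : Finset.univ.image s = {s 0, s 1, s 2} := by
    ext b
    simp [Fin.exists_fin_succ, eq_comm]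
  have hs' : ∀ i, s i ∈ u.alive := fun i => Fintype.mem_piFinset.mp hs i
  unfold countIn
  split_ifs with h <;> congr 1 <;> ext b
  · simp only [Urn.relabel, him, Finset.mem_filter, Finset.mem_union]
    split_ifs with hb
    · simp only [h, hb, or_true, and_true, iff_true]
      simp only [Finset.mem_insert, Finset.mem_singleton] at hb
      rcases hb with rfl | rfl | rfl <;> exact hs' _
    · simp [hb]
  · simp only [Urn.relabel, him, Finset.mem_filter, Finset.mem_sdiff]
    split_ifs with hb <;> simp [h, hb]

/-- The median lies in `S` exactly if two of the draws do, so the count rises by one when exactly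
two draws are in `S`, falls by one when exactly one is, and otherwise stays; a ball drawn repeatedly
does not change this. Written with indicators, each pattern sums to a product over the three draws,
and harmonicity of `lowProb` cancels the changes. -/
theorem sum_lowProb_truthfulNext {p : Fin n → ℝ} (hp : Function.Injective p) (u : Urn n k)
    {S : Finset (Fin n)} (hS : IsLeftClosed p S) :
    ∑ s ∈ u.samples, lowProb u.alive.card (countIn (truthfulNext p u s) S) =
      (u.alive.card : ℝ) ^ 3 * lowProb u.alive.card (countIn u S) := by
  set N := u.alive.card with hN
  set T := u.alive.filter fun b => u.label b ∈ S with hT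
  have ha : countIn u S = T.card := rfl
  rw [ha]
  set e : Ball n k → ℝ := fun b => if b ∈ T then 1 else 0 with he
  set up := lowProb N (T.card + 1) - lowProb N T.card with hup
  set dn := lowProb N (T.card - 1) - lowProb N T.card with hdn
  have hterm : ∀ s ∈ u.samples, lowProb N (countIn (truthfulNext p u s) S) =
      lowProb N T.card +
      up * (e (s 0) * e (s 1) * (1 - e (s 2)) + e (s 0) * (1 - e (s 1)) * e (s 2) +
        (1 - e (s 0)) * e (s 1) * e (s 2)) +
      dn * ((1 - e (s 0)) * (1 - e (s 1)) * e (s 2) + (1 - e (s 0)) * e (s 1) * (1 - e (s 2)) +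
        e (s 0) * (1 - e (s 1)) * (1 - e (s 2))) := by
    intro s hs
    obtain ⟨w, hw, hmed⟩ := exists_truthfulNext_eq hp u s
    have hs' : ∀ i, s i ∈ u.alive := fun i => Fintype.mem_piFinset.mp hs i
    have hmem : ∀ i, u.label (s i) ∈ S ↔ s i ∈ T := fun i => by simp [hT, hs' i]
    have hiff : w ∈ S ↔ s 0 ∈ T ∧ s 1 ∈ T ∨ s 0 ∈ T ∧ s 2 ∈ T ∨ s 1 ∈ T ∧ s 2 ∈ T := by
      rw [hmed S hS]
      simp only [hmem]
      constructor
      · rintro ⟨i, j, hij, hi, hj⟩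
        fin_cases i <;> fin_cases j <;> simp_all
      · rintro (h | h | h)
        · exact ⟨0, 1, by decide, h⟩
        · exact ⟨0, 2, by decide, h⟩
        · exact ⟨1, 2, by decide, h⟩
    rw [hw, countIn_relabel u hs, ← hT]
    by_cases h0 : s 0 ∈ T <;> by_cases h1 : s 1 ∈ T <;> by_cases h2 : s 2 ∈ T <;>
      simp [hiff, he, hup, hdn, h0, h1, h2, Finset.sdiff_insert, Finset.sdiff_singleton_eq_erase,
        Finset.card_insert_of_notMem, Finset.card_erase_of_mem]
  rw [Finset.sum_congr rfl hterm]
  simp only [Finset.sum_add_distrib, ← Finset.mul_sum, Finset.sum_const, nsmul_eq_mul,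
    card_samples]
  have h2 := sum_samples_mul u e e (fun b => 1 - e b)
  have h3 := sum_samples_mul u e (fun b => 1 - e b) e
  have h4 := sum_samples_mul u (fun b => 1 - e b) e e
  have h5 := sum_samples_mul u (fun b => 1 - e b) (fun b => 1 - e b) e
  have h6 := sum_samples_mul u (fun b => 1 - e b) e (fun b => 1 - e b)
  have h7 := sum_samples_mul u e (fun b => 1 - e b) (fun b => 1 - e b)
  have hTle : T.card ≤ N := Finset.card_filter_le _ _
  have hse : ∑ b ∈ u.alive, e b = T.card := by
    rw [he, Finset.sum_ite_mem, Finset.inter_eq_right.mpr (Finset.filter_subset _ _)]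
    rw [Finset.sum_const, nsmul_eq_mul, mul_one]
  have hse' : ∑ b ∈ u.alive, (1 - e b) = N - T.card := by
    rw [Finset.sum_sub_distrib, hse]
    simp [hN]
  rw [h2, h3, h4, h5, h6, h7, hse, hse', ← hN]
  push_cast
  have := lowProb_harmonic hTle
  linear_combination 3 * this

theorem sum_truthfulLaw_truthfulNext {p : Fin n → ℝ} (hp : Function.Injective p) {u : Urn n k}
    (hu : u.alive.Nonempty) (w : Fin n) :
    ∑ s ∈ u.samples, truthfulLaw p (truthfulNext p u s) w =
      (u.samples.card : ℝ) * truthfulLaw p u w := by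
  simp only [truthfulLaw, alive_truthfulNext hp, hu, if_true]
  rw [Finset.sum_sub_distrib, sum_lowProb_truthfulNext hp u (isLeftClosed_upTo p w),
    sum_lowProb_truthfulNext hp u (isLeftClosed_leftOf p w), card_samples, ← mul_sub]
  push_cast
  ring

/-- The expected value of `c` at the winner, for a given urn, if everybody votes truthfully. -/
noncomputable def truthfulValue (p : Fin n → ℝ) (c : Fin n → ℝ) (u : Urn n k) : ℝ :=
  ∑ w, truthfulLaw p u w * c w

theorem sum_truthfulValue_truthfulNext {p : Fin n → ℝ} (hp : Function.Injective p)
    (c : Fin n → ℝ) {u : Urn n k} (hu : u.alive.Nonempty) :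
    ∑ s ∈ u.samples, truthfulValue p c (truthfulNext p u s) =
      (u.samples.card : ℝ) * truthfulValue p c u := by
  simp only [truthfulValue]
  rw [Finset.sum_comm, Finset.mul_sum]
  simp only [← Finset.sum_mul, sum_truthfulLaw_truthfulNext hp hu, mul_assoc]

theorem truthfulValue_add_const {p : Fin n → ℝ} (hp : Function.Injective p) (c : Fin n → ℝ)
    (K : ℝ) {u : Urn n k} (hu : u.Proper) :
    truthfulValue p (fun w => c w + K) u = truthfulValue p c u + K := by
  simp only [truthfulValue, mul_add, Finset.sum_add_distrib, ← Finset.sum_mul,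
    sum_truthfulLaw hp hu, one_mul]

theorem truthfulValue_nonneg (p : Fin n → ℝ) {c : Fin n → ℝ} (hc : ∀ w, 0 ≤ c w) (u : Urn n k) :
    0 ≤ truthfulValue p c u :=
  Finset.sum_nonneg fun w _ => mul_nonneg (truthfulLaw_nonneg p u w) (hc w)

theorem sum_winProb_mul_ofReal_le {p : Fin n → ℝ} (hp : Function.Injective p) {m : Mechanism}
    {σ : Profile n k} {c : Fin n → ℝ} (hc : ∀ w, 0 ≤ c w)
    (h : ∀ (l : List (Event n k)) (u : Urn n k), u.Undecided → ∀ s ∈ u.samples,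
      ∀ e ∈ (sampleLaw m σ l u s).support,
        truthfulValue p c (u.next e) ≤ truthfulValue p c (truthfulNext p u s)) (u₀ : Urn n k) :
    ∑ w, winProb m σ u₀ w * ENNReal.ofReal (c w) ≤ ENNReal.ofReal (truthfulValue p c u₀) := by
  refine sum_winProb_mul_le m σ u₀ (fun u => ENNReal.ofReal (truthfulValue p c u)) _
    (fun l u hu => ?_) fun u => ?_
  · have hpos : 0 < u.samples.card := by
      rw [card_samples]
      exact Nat.pow_pos (Finset.card_pos.mpr hu.nonempty)
    rw [expect_eventLaw, ENNReal.div_le_iff_le_mul (Or.inl (by exact_mod_cast hpos.ne'))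
      (Or.inl (ENNReal.natCast_ne_top _))]
    calc ∑ s ∈ u.samples, expect (sampleLaw m σ l u s)
          (fun e => ENNReal.ofReal (truthfulValue p c (u.next e)))
        ≤ ∑ s ∈ u.samples, ENNReal.ofReal (truthfulValue p c (truthfulNext p u s)) :=
          Finset.sum_le_sum fun s hs =>
            (expect_mono fun e he => ENNReal.ofReal_le_ofReal (h l u hu s hs e he)).trans
              (expect_const _ _).le
      _ = ENNReal.ofReal (u.samples.card * truthfulValue p c u) := by
          rw [← ENNReal.ofReal_sum_of_nonneg fun s _ => truthfulValue_nonneg p hc _,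
            sum_truthfulValue_truthfulNext hp c hu.nonempty]
      _ = _ := by rw [mul_comm, ENNReal.ofReal_mul (truthfulValue_nonneg p hc u),
            ENNReal.ofReal_natCast]
  · by_cases hu : u.Undecided
    · simp [report_of_undecided hu]
    · rw [truthfulValue, ENNReal.ofReal_sum_of_nonneg
        fun w _ => mul_nonneg (truthfulLaw_nonneg p u w) (hc w)]
      refine Finset.sum_le_sum fun w _ => ?_
      rw [report_eq_truthfulLaw hp hu, ENNReal.ofReal_mul (truthfulLaw_nonneg p u w)]

theorem winProb_ne_top (m : Mechanism) (σ : Profile n k) {u₀ : Urn n k} (hu₀ : u₀.Proper)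
    (w : Fin n) : winProb m σ u₀ w ≠ ⊤ := by
  refine ne_top_of_le_ne_top ENNReal.one_ne_top ?_
  rw [← sum_winProb m σ hu₀]
  exact Finset.single_le_sum (f := fun w => winProb m σ u₀ w) (fun _ _ => zero_le)
    (Finset.mem_univ w)

theorem sum_toReal_winProb (m : Mechanism) (σ : Profile n k) {u₀ : Urn n k} (hu₀ : u₀.Proper) :
    ∑ w, (winProb m σ u₀ w).toReal = 1 := by
  rw [← ENNReal.toReal_sum fun w _ => winProb_ne_top m σ hu₀ w, sum_winProb m σ hu₀,
    ENNReal.toReal_one]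

/-- If no event is better, for the payoff `c`, than a truthful vote, then the expected payoff is at
most the one under truthful voting. -/
theorem sum_toReal_winProb_mul_le {p : Fin n → ℝ} (hp : Function.Injective p) {m : Mechanism}
    {σ : Profile n k} {c : Fin n → ℝ}
    (h : ∀ (l : List (Event n k)) (u : Urn n k), u.Undecided → ∀ s ∈ u.samples,
      ∀ e ∈ (sampleLaw m σ l u s).support,
        truthfulValue p c (u.next e) ≤ truthfulValue p c (truthfulNext p u s))
    {u₀ : Urn n k} (hu₀ : u₀.Proper) :
    ∑ w, (winProb m σ u₀ w).toReal * c w ≤ truthfulValue p c u₀ := by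
  -- The bound is available for nonnegative payoffs only. Adding a constant `K` shifts both sides
  -- equally, because the winning probabilities and the truthful law both have total mass 1.
  set K := ∑ w, |c w| with hK
  have hcK : ∀ w, 0 ≤ c w + K := fun w => by
    have h1 := Finset.single_le_sum (f := fun w => |c w|) (fun _ _ => abs_nonneg _)
      (Finset.mem_univ w)
    have h2 := neg_abs_le (c w)
    linarith
  have key := sum_winProb_mul_ofReal_le hp (m := m) (σ := σ) hcK (fun l u hu s hs e he => by
    have hu' : u.Proper := Or.inl hu.nonempty
    rw [truthfulValue_add_const hp c K (Urn.proper_next hu' e), truthfulNext,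
      truthfulValue_add_const hp c K (Urn.proper_next hu' _)]
    exact add_le_add_left (h l u hu s hs e he) K) u₀
  have key' := ENNReal.toReal_mono ENNReal.ofReal_ne_top key
  rw [ENNReal.toReal_ofReal (truthfulValue_nonneg p hcK u₀), truthfulValue_add_const hp c K hu₀,
    ENNReal.toReal_sum fun w _ => ENNReal.mul_ne_top (winProb_ne_top m σ hu₀ w)
      ENNReal.ofReal_ne_top] at key'
  simp only [ENNReal.toReal_mul, ENNReal.toReal_ofReal (hcK _), mul_add, Finset.sum_add_distrib,
    ← Finset.sum_mul, sum_toReal_winProb m σ hu₀, one_mul] at key'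
  linarith

/-- If every event has the outcome of a truthful vote, then so has the procedure. -/
theorem toReal_winProb_eq {p : Fin n → ℝ} (hp : Function.Injective p) {m : Mechanism}
    {σ : Profile n k}
    (h : ∀ (l : List (Event n k)) (u : Urn n k), u.Undecided → ∀ s ∈ u.samples,
      ∀ e ∈ (sampleLaw m σ l u s).support, u.next e = truthfulNext p u s)
    {u₀ : Urn n k} (hu₀ : u₀.Proper) (w : Fin n) :
    (winProb m σ u₀ w).toReal = truthfulLaw p u₀ w := by
  -- The payoff that is the indicator of `w` gives one inequality for each `w`; as both sides have
  -- total mass 1, none of them is strict.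
  have hle : ∀ w ∈ Finset.univ, (winProb m σ u₀ w).toReal ≤ truthfulLaw p u₀ w := fun w _ => by
    have := sum_toReal_winProb_mul_le hp (m := m) (σ := σ) (c := Pi.single w 1)
      (fun l u hu s hs e he => (congrArg _ (h l u hu s hs e he)).le) hu₀
    simpa [truthfulValue, Pi.single_apply] using this
  refine (Finset.sum_eq_sum_iff_of_le hle).mp ?_ w (Finset.mem_univ w)
  rw [sum_toReal_winProb m σ hu₀, sum_truthfulLaw hp hu₀]

/-! ### Comparison of expected utilities -/

/-- Abel summation: the rightmost element is split off and the induction hypothesis is used with its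
value `g a` as the bound. Raising `g a` to `M` only lowers the product, since the sum of `D` over
the set is nonpositive. -/
theorem le_sum_mul_of_isLeftClosed {p : Fin n → ℝ} (hp : Function.Injective p) {y : Fin n}
    {D g : Fin n → ℝ} (hD : ∀ S, IsLeftClosed p S → y ∉ S → ∑ w ∈ S, D w ≤ 0)
    (hg : ∀ a b, p a ≤ p b → p b ≤ p y → g a ≤ g b) (S : Finset (Fin n))
    (hS : IsLeftClosed p S) (hy : y ∉ S) (M : ℝ) (hM : ∀ w ∈ S, g w ≤ M) :
    M * ∑ w ∈ S, D w ≤ ∑ w ∈ S, D w * g w := by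
  induction S using Finset.induction_on_max_value p generalizing M with
  | empty => simp
  | insert a S ha hmax ih =>
    have hay : p a ≤ p y := le_of_not_ge fun h => hy (hS y a h (Finset.mem_insert_self a S))
    have hS' : IsLeftClosed p S := fun x v hxv hv => by
      rcases Finset.mem_insert.mp (hS x v hxv (Finset.mem_insert_of_mem hv)) with rfl | h
      · exact absurd (hp (le_antisymm (hmax v hv) hxv) ▸ hv) ha
      · exact h
    have h1 := ih hS' (fun h => hy (Finset.mem_insert_of_mem h)) (g a)
      fun w hw => hg w a (hmax w hw) hay
    have h2 := hD _ hS hy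
    have h3 := hM a (Finset.mem_insert_self a S)
    rw [Finset.sum_insert ha] at h2 ⊢
    rw [Finset.sum_insert ha]
    nlinarith

/-- A signed measure `D` that is nonpositive on all the left-closed sets without `y` charges
nonnegatively, left of `y`, a function that increases up to `y`. -/
theorem sum_leftOf_nonneg {p : Fin n → ℝ} (hp : Function.Injective p) {y : Fin n}
    {D g : Fin n → ℝ} (hD : ∀ S, IsLeftClosed p S → y ∉ S → ∑ w ∈ S, D w ≤ 0)
    (hg : ∀ a b, p a ≤ p b → p b ≤ p y → g a ≤ g b) :
    0 ≤ ∑ w ∈ leftOf p y, D w * (g w - g y) := by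
  have hmem : ∀ w, w ∈ leftOf p y ↔ p w < p y := fun w => by simp [leftOf]
  have := le_sum_mul_of_isLeftClosed hp hD hg (leftOf p y) (isLeftClosed_leftOf p y)
    (by simp [hmem]) (g y) fun w hw => hg w y ((hmem w).mp hw).le le_rfl
  simp only [mul_sub, Finset.sum_sub_distrib, ← Finset.sum_mul]
  linarith

/-- As `D` has total mass 0, the value `g y` may be subtracted. The right side of `y` is the left
side after reflection, so one-sided estimates need only be proved once. -/
theorem sum_mul_eq_leftOf_add {p : Fin n → ℝ} (hp : Function.Injective p) (y : Fin n)
    {D : Fin n → ℝ} (h0 : ∑ w, D w = 0) (g : Fin n → ℝ) :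
    ∑ w, D w * g w = ∑ w ∈ leftOf p y, D w * (g w - g y) +
      ∑ w ∈ leftOf (fun w => -p w) y, D w * (g w - g y) := by
  have h1 : ∑ w, D w * g w = ∑ w, D w * (g w - g y) := by
    simp only [mul_sub, Finset.sum_sub_distrib, ← Finset.sum_mul, h0, zero_mul, sub_zero]
  rw [h1, leftOf, leftOf, Finset.sum_filter, Finset.sum_filter, ← Finset.sum_add_distrib]
  refine Finset.sum_congr rfl fun w _ => ?_
  rcases lt_trichotomy (p w) (p y) with h | h | h
  · simp [h, h.le]
  · simp [hp h]
  · simp [h, h.le]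

theorem sum_mul_nonneg_of_unimodal {p : Fin n → ℝ} (hp : Function.Injective p) {y : Fin n}
    {D g : Fin n → ℝ} (h0 : ∑ w, D w = 0)
    (hl : ∀ S, IsLeftClosed p S → y ∉ S → ∑ w ∈ S, D w ≤ 0)
    (hr : ∀ S, IsLeftClosed (fun w => -p w) S → y ∉ S → ∑ w ∈ S, D w ≤ 0)
    (hgl : ∀ a b, p a ≤ p b → p b ≤ p y → g a ≤ g b)
    (hgr : ∀ a b, p y ≤ p a → p a ≤ p b → g b ≤ g a) :
    0 ≤ ∑ w, D w * g w := by
  rw [sum_mul_eq_leftOf_add hp y h0]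
  exact add_nonneg (sum_leftOf_nonneg hp hl hgl)
    (sum_leftOf_nonneg (neg_injective.comp hp) hr fun a b hab hb =>
      hgr b a (neg_le_neg_iff.mp hb) (neg_le_neg_iff.mp hab))

theorem slope_le_slope_of_concaveOn {G : ℝ → ℝ} (hG : ConcaveOn ℝ Set.univ G) {a b c d : ℝ}
    (hab : a < b) (hbc : b ≤ c) (hcd : c < d) :
    (G d - G c) / (d - c) ≤ (G b - G a) / (b - a) := by
  rcases hbc.eq_or_lt with rfl | hbc
  · exact hG.slope_anti_adjacent (Set.mem_univ _) (Set.mem_univ _) hab hcd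
  · exact (hG.slope_anti_adjacent (Set.mem_univ _) (Set.mem_univ _) hbc hcd).trans
      (hG.slope_anti_adjacent (Set.mem_univ _) (Set.mem_univ _) hab hbc)

theorem concaveOn_comp_dist {f : ℝ → ℝ} (hf : StrictAntiOn f (Set.Ici 0))
    (hc : ConcaveOn ℝ (Set.Ici 0) f) (z : ℝ) : ConcaveOn ℝ Set.univ fun v => f (dist z v) := by
  refine ⟨convex_univ, fun v _ w _ a b ha hb hab => ?_⟩
  refine (hc.2 (x := dist z v) (y := dist z w) dist_nonneg dist_nonneg ha hb hab).trans ?_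
  refine hf.antitoneOn dist_nonneg ?_ ?_
  · exact add_nonneg (smul_nonneg ha dist_nonneg) (smul_nonneg hb dist_nonneg)
  · simp only [Real.dist_eq, smul_eq_mul]
    calc |z - (a * v + b * w)| = |a * (z - v) + b * (z - w)| := by
          congr 1
          linear_combination (-z) * hab
      _ ≤ |a * (z - v)| + |b * (z - w)| := abs_add_le _ _
      _ = _ := by rw [abs_mul, abs_mul, abs_of_nonneg ha, abs_of_nonneg hb]

/-- A move of probability towards `y` that does not move the mean to the left benefits everybody
on the right of `y`. -/
theorem sum_mul_utility_nonneg {p : Fin n → ℝ} (hp : Function.Injective p) {y z : Fin n}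
    {D : Fin n → ℝ} (h0 : ∑ w, D w = 0)
    (hl : ∀ S, IsLeftClosed p S → y ∉ S → ∑ w ∈ S, D w ≤ 0)
    (hr : ∀ S, IsLeftClosed (fun w => -p w) S → y ∉ S → ∑ w ∈ S, D w ≤ 0)
    (hyz : p y < p z) (hmean : 0 ≤ ∑ w, D w * p w) {f : ℝ → ℝ}
    (hf : StrictAntiOn f (Set.Ici 0)) (hc : ConcaveOn ℝ (Set.Ici 0) f) :
    0 ≤ ∑ w, D w * f (dist (p z) (p w)) := by
  set G : ℝ → ℝ := fun v => f (dist (p z) v) with hGdef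
  have hG : ConcaveOn ℝ Set.univ G := concaveOn_comp_dist hf hc (p z)
  -- The next participant to the right of `y`. The chord of `G` from `y` to `y'` has nonnegative
  -- slope `s`, since `y'` is not beyond the peak `z`. No participant lies strictly between `y` and
  -- `y'`, where `G` may exceed the chord.
  obtain ⟨y', hy', hmin⟩ := Finset.exists_min_image (Finset.univ.filter fun w => p y < p w) p
    ⟨z, by simpa using hyz⟩
  simp only [Finset.mem_filter, Finset.mem_univ, true_and] at hy' hmin
  set s := (G (p y') - G (p y)) / (p y' - p y) with hs
  have hsy : G (p y') - G (p y) = s * (p y' - p y) := by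
    rw [hs, div_mul_cancel₀ _ (sub_pos.mpr hy').ne']
  have hs0 : 0 ≤ s := by
    have hz := hmin z hyz
    refine div_nonneg (sub_nonneg.mpr (hf.antitoneOn dist_nonneg dist_nonneg ?_))
      (sub_pos.mpr hy').le
    rw [Real.dist_eq, Real.dist_eq, abs_of_nonneg (by linarith), abs_of_nonneg (by linarith)]
    linarith
  have hright : ∀ a b, p y' ≤ p a → p a ≤ p b → G (p b) - s * p b ≤ G (p a) - s * p a := by
    intro a b ha hab
    rcases hab.eq_or_lt with h | h
    · rw [h]
    · have := slope_le_slope_of_concaveOn hG hy' ha h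
      rw [← hs, div_le_iff₀ (sub_pos.mpr h)] at this
      linarith
  -- By concavity the slopes of `G` are at least `s` left of `y` and at most `s` right of `y'`. So
  -- `G` minus the line of slope `s` is unimodal with peak at `y` on the participants, and the line
  -- itself is handled by the mean.
  have key : 0 ≤ ∑ w, D w * (G (p w) - s * p w) := by
    refine sum_mul_nonneg_of_unimodal hp h0 hl hr ?_ ?_
    · intro a b hab hb
      rcases hab.eq_or_lt with h | h
      · rw [h]
      · have := slope_le_slope_of_concaveOn hG h hb hy'
        rw [← hs, le_div_iff₀ (sub_pos.mpr h)] at this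
        linarith
    · intro a b ha hab
      rcases ha.eq_or_lt with h | h
      · rw [← h] at hab ⊢
        rcases hab.eq_or_lt with h' | h'
        · rw [h']
        · have := hright y' b le_rfl (hmin b h')
          linarith
      · exact hright a b (hmin a h) hab
  have hsplit : ∑ w, D w * (G (p w) - s * p w) =
      ∑ w, D w * G (p w) - s * ∑ w, D w * p w := by
    rw [Finset.mul_sum, ← Finset.sum_sub_distrib]
    exact Finset.sum_congr rfl fun w _ => by ring
  have := mul_nonneg hs0 hmean
  linarith

/-- The mean moves weakly to the right or weakly to the left; the second case is the first one
reflected. -/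
theorem sum_mul_utility_nonneg_or {p : Fin n → ℝ} (hp : Function.Injective p) {x y z : Fin n}
    {D : Fin n → ℝ} (h0 : ∑ w, D w = 0)
    (hl : ∀ S, IsLeftClosed p S → y ∉ S → ∑ w ∈ S, D w ≤ 0)
    (hr : ∀ S, IsLeftClosed (fun w => -p w) S → y ∉ S → ∑ w ∈ S, D w ≤ 0)
    (hxy : p x < p y) (hyz : p y < p z) {f : Fin n → ℝ → ℝ}
    (hf : ∀ x, StrictAntiOn (f x) (Set.Ici 0)) (hc : ∀ x, ConcaveOn ℝ (Set.Ici 0) (f x)) :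
    0 ≤ ∑ w, D w * utility p f x w ∨ 0 ≤ ∑ w, D w * utility p f z w := by
  rcases le_total 0 (∑ w, D w * p w) with h | h
  · exact Or.inr (sum_mul_utility_nonneg hp h0 hl hr hyz h (hf z) (hc z))
  · left
    have := sum_mul_utility_nonneg (neg_injective.comp hp) h0 hr
      (fun S hS => hl S (by simpa [IsLeftClosed] using hS)) (neg_lt_neg hxy)
      (by simpa using h) (hf x) (hc x)
    simpa [utility, dist_neg_neg] using this

/-! ### The possible outcomes of a vote -/

/-- The urn after the removal is the common reference point for comparing different winners with one
another and with a tie. -/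
theorem countIn_relabel_eq_add {u : Urn n k} {s : Fin 3 → Ball n k} (hs : s ∈ u.samples)
    (w : Fin n) (S : Finset (Fin n)) :
    countIn (u.relabel s w) S =
      countIn (u.remove s) S + if w ∈ S then (Finset.univ.image s).card else 0 := by
  have hsub : Finset.univ.image s ⊆ u.alive := fun b hb => by
    obtain ⟨i, -, rfl⟩ := Finset.mem_image.mp hb
    exact Fintype.mem_piFinset.mp hs i
  have h : ((u.relabel s w).alive.filter fun b => (u.relabel s w).label b ∈ S) =
      ((u.remove s).alive.filter fun b => (u.remove s).label b ∈ S) ∪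
        if w ∈ S then Finset.univ.image s else ∅ := by
    ext b
    rw [Finset.mem_union, Finset.mem_filter, Finset.mem_filter]
    simp only [Urn.relabel, Urn.remove, Finset.mem_sdiff]
    by_cases hb : b ∈ Finset.univ.image s
    · by_cases hw : w ∈ S
      · simp only [hb, hw, if_true, and_true, not_true, and_false, false_and, false_or, iff_true]
        exact hsub hb
      · simp [hb, hw]
    · have : b ∉ (if w ∈ S then Finset.univ.image s else ∅) := by
        split_ifs
        · exact hb
        · simp
      simp only [hb, this, if_false, not_false_eq_true, and_true, or_false]
  unfold countIn
  rw [h, Finset.card_union_of_disjoint]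
  · split_ifs <;> simp
  · rw [Finset.disjoint_left]
    intro b hb hb'
    have h1 := (Finset.mem_sdiff.mp (Finset.mem_filter.mp hb).1).2
    split_ifs at hb'
    · exact h1 hb'
    · simp at hb'

/-- Reduces sets closed to the right to their left-closed complements, on which the law is explicit.
-/
theorem sum_truthfulLaw_compl {p : Fin n → ℝ} (hp : Function.Injective p) {u : Urn n k}
    (hu : u.Proper) (S : Finset (Fin n)) :
    ∑ w ∈ S, truthfulLaw p u w = 1 - ∑ w ∈ Sᶜ, truthfulLaw p u w := by
  rw [← sum_truthfulLaw hp hu, ← Finset.sum_add_sum_compl S]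
  ring

theorem IsLeftClosed.compl {p : Fin n → ℝ} {S : Finset (Fin n)}
    (hS : IsLeftClosed (fun w => -p w) S) : IsLeftClosed p Sᶜ := fun a b hab hb => by
  rw [Finset.mem_compl] at hb ⊢
  exact fun ha => hb (hS b a (neg_le_neg hab) ha)

/-- One of the two outer candidates weakly prefers the win of the median to the removal. -/
theorem truthfulValue_remove_le_or {p : Fin n → ℝ} (hp : Function.Injective p) {u : Urn n k}
    {s : Fin 3 → Ball n k} (hs : s ∈ u.samples) (hinj : Function.Injective s) {x y z : Fin n}
    (hxy : p x < p y) (hyz : p y < p z) {f : Fin n → ℝ → ℝ}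
    (hf : ∀ x, StrictAntiOn (f x) (Set.Ici 0)) (hc : ∀ x, ConcaveOn ℝ (Set.Ici 0) (f x)) :
    truthfulValue p (utility p f x) (u.remove s) ≤
        truthfulValue p (utility p f x) (u.relabel s y) ∨
      truthfulValue p (utility p f z) (u.remove s) ≤
        truthfulValue p (utility p f z) (u.relabel s y) := by
  have hcard : (Finset.univ.image s).card = 3 := by
    rw [Finset.card_image_of_injective _ hinj]
    simp
  have hsub : Finset.univ.image s ⊆ u.alive := fun b hb => by
    obtain ⟨i, -, rfl⟩ := Finset.mem_image.mp hb
    exact Fintype.mem_piFinset.mp hs i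
  have hN : (u.relabel s y).alive.card = (u.remove s).alive.card + 3 := by
    rw [← hcard]
    exact (Finset.card_sdiff_add_card_eq_card hsub).symm
  have hrel : (u.relabel s y).alive.Nonempty := Finset.card_pos.mp (by omega)
  have hrel' : (u.relabel s y).Proper := Or.inl hrel
  have hrem' : (u.remove s).Proper := Urn.proper_remove u s
  have key := sum_mul_utility_nonneg_or hp
    (D := fun w => truthfulLaw p (u.relabel s y) w - truthfulLaw p (u.remove s) w)
    (by rw [Finset.sum_sub_distrib, sum_truthfulLaw hp hrel', sum_truthfulLaw hp hrem', sub_self])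
    (fun S hS hy => by
      rw [Finset.sum_sub_distrib, sub_nonpos, sum_truthfulLaw_of_isLeftClosed hp hrel hS,
        countIn_relabel_eq_add hs, if_neg hy, add_zero, hN]
      by_cases h : (u.remove s).alive.Nonempty
      · rw [sum_truthfulLaw_of_isLeftClosed hp h hS]
        exact lowProb_add_le (Finset.card_pos.mpr h) 3 _
      -- The removal empties the urn, so after a win of `y` all balls carry the label `y` and `S`
      -- has probability 0.
      · have h0 := countIn_le (u.remove s) S
        rw [Finset.not_nonempty_iff_eq_empty.mp h, Finset.card_empty, Nat.le_zero] at h0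
        rw [h0, lowProb_zero]
        exact Finset.sum_nonneg fun w _ => truthfulLaw_nonneg p _ w)
    (fun S hS hy => by
      have hy' : y ∈ Sᶜ := Finset.mem_compl.mpr hy
      rw [Finset.sum_sub_distrib, sub_nonpos, sum_truthfulLaw_compl hp hrel',
        sum_truthfulLaw_of_isLeftClosed hp hrel hS.compl, countIn_relabel_eq_add hs, if_pos hy',
        hcard, hN]
      by_cases h : (u.remove s).alive.Nonempty
      · rw [sum_truthfulLaw_compl hp hrem', sum_truthfulLaw_of_isLeftClosed hp h hS.compl]
        exact sub_le_sub_left (lowProb_le_add_add (Finset.card_pos.mpr h) 3 _) 1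
      · have h0 := countIn_le (u.remove s) Sᶜ
        rw [Finset.not_nonempty_iff_eq_empty.mp h, Finset.card_empty, Nat.le_zero] at h0
        rw [h0, Finset.not_nonempty_iff_eq_empty.mp h, Finset.card_empty, lowProb_self (by omega),
          sub_self]
        exact Finset.sum_nonneg fun w _ => truthfulLaw_nonneg p _ w)
    hxy hyz hf hc
  simpa only [truthfulValue, sub_mul, Finset.sum_sub_distrib, sub_nonneg] using key

theorem utility_le_utility {p : Fin n → ℝ} {f : Fin n → ℝ → ℝ} {x v w : Fin n}
    (hf : StrictAntiOn (f x) (Set.Ici 0)) (h : |p x - p v| ≤ |p x - p w|) :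
    utility p f x w ≤ utility p f x v :=
  hf.antitoneOn dist_nonneg dist_nonneg h

/-- A participant prefers a win of `y` to a win of someone farther away in the same direction. -/
theorem truthfulValue_relabel_le {p : Fin n → ℝ} (hp : Function.Injective p) {u : Urn n k}
    {s : Fin 3 → Ball n k} (hs : s ∈ u.samples) {x y z : Fin n}
    (h : p x < p y ∧ p y < p z ∨ p z < p y ∧ p y < p x) {f : Fin n → ℝ → ℝ}
    (hf : StrictAntiOn (f x) (Set.Ici 0)) :
    truthfulValue p (utility p f x) (u.relabel s z) ≤
      truthfulValue p (utility p f x) (u.relabel s y) := by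
  have hu : u.alive.Nonempty := ⟨s 0, Fintype.mem_piFinset.mp hs 0⟩
  have hz : (u.relabel s z).alive.Nonempty := hu
  have hy : (u.relabel s y).alive.Nonempty := hu
  have hN : (u.relabel s y).alive.card = (u.relabel s z).alive.card := rfl
  set D : Fin n → ℝ := fun w => truthfulLaw p (u.relabel s y) w - truthfulLaw p (u.relabel s z) w
    with hD
  have h0 : ∑ w, D w = 0 := by
    rw [hD, Finset.sum_sub_distrib, sum_truthfulLaw hp (Or.inl hy), sum_truthfulLaw hp (Or.inl hz),
      sub_self]
  have hcount : ∀ S : Finset (Fin n), (y ∈ S ↔ z ∈ S) →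
      countIn (u.relabel s y) S = countIn (u.relabel s z) S := fun S hS => by
    rw [countIn_relabel_eq_add hs, countIn_relabel_eq_add hs, if_congr hS rfl rfl]
  have hzero : ∀ w, (y ∈ upTo p w ↔ z ∈ upTo p w) → (y ∈ leftOf p w ↔ z ∈ leftOf p w) →
      D w = 0 := fun w h1 h2 => by
    simp only [hD, truthfulLaw, hy, hz, if_true]
    rw [hcount _ h1, hcount _ h2, hN, sub_self]
  have hmem : ∀ v w, v ∈ upTo p w ↔ p v ≤ p w := fun v w => by simp [upTo]
  have hmem' : ∀ v w, v ∈ leftOf p w ↔ p v < p w := fun v w => by simp [leftOf]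
  have key : 0 ≤ ∑ w, D w * utility p f x w := by
    rw [sum_mul_eq_leftOf_add hp y h0]
    rcases h with ⟨hxy, hyz⟩ | ⟨hzy, hyx⟩
    -- Left of `y` the two laws agree, since neither `y` nor `z` is counted there. Right of `y`, a
    -- win of `y` puts less mass on every right-closed set without `y`, and the utility of `x`
    -- decreases in that direction.
    · rw [Finset.sum_eq_zero fun w hw => ?_, zero_add]
      · refine sum_leftOf_nonneg (neg_injective.comp hp) (fun S hS hyS => ?_)
          fun a b hab hb => utility_le_utility hf ?_
        · have hyS' : y ∈ Sᶜ := Finset.mem_compl.mpr hyS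
          rw [hD, Finset.sum_sub_distrib, sub_nonpos, sum_truthfulLaw_compl hp (Or.inl hy),
            sum_truthfulLaw_compl hp (Or.inl hz),
            sum_truthfulLaw_of_isLeftClosed hp hy hS.compl,
            sum_truthfulLaw_of_isLeftClosed hp hz hS.compl, hN]
          refine sub_le_sub_left (lowProb_mono _ ?_) 1
          rw [countIn_relabel_eq_add hs, countIn_relabel_eq_add hs, if_pos hyS']
          refine Nat.add_le_add_left ?_ _
          split_ifs <;> omega
        · simp only [Function.comp_apply, neg_le_neg_iff] at hab hb
          rw [abs_of_nonpos (by linarith), abs_of_nonpos (by linarith)]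
          linarith
      · rw [hmem'] at hw
        rw [hzero w, zero_mul]
        · rw [hmem, hmem]
          constructor <;> intro <;> linarith
        · rw [hmem', hmem']
          constructor <;> intro <;> linarith
    · rw [Finset.sum_eq_zero (s := leftOf (fun w => -p w) y) fun w hw => ?_, add_zero]
      · refine sum_leftOf_nonneg hp (fun S hS hyS => ?_)
          fun a b hab hb => utility_le_utility hf ?_
        · rw [hD, Finset.sum_sub_distrib, sub_nonpos, sum_truthfulLaw_of_isLeftClosed hp hy hS,
            sum_truthfulLaw_of_isLeftClosed hp hz hS, hN]
          refine lowProb_mono _ ?_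
          rw [countIn_relabel_eq_add hs, countIn_relabel_eq_add hs, if_neg hyS]
          omega
        · rw [abs_of_nonneg (by linarith), abs_of_nonneg (by linarith)]
          linarith
      · simp only [leftOf, Finset.mem_filter, Finset.mem_univ, true_and, neg_lt_neg_iff] at hw
        rw [hzero w, zero_mul]
        · rw [hmem, hmem]
          constructor <;> intro <;> linarith
        · rw [hmem', hmem']
          constructor <;> intro <;> linarith
  simpa only [truthfulValue, hD, sub_mul, Finset.sum_sub_distrib, sub_nonneg] using key

/-! ### Strategies of those who should not win -/

/-- Everybody who should not win votes truthfully. -/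
def LosersTruthful (p : Fin n → ℝ) (σ : Profile n k) : Prop :=
  ∀ x q i, ¬ ShouldWin p q i → σ x q i = PMF.pure (truthfulBallot p q i)

theorem losersTruthful_truthful (p : Fin n → ℝ) : LosersTruthful p (truthful p : Profile n k) :=
  fun _ _ _ _ => rfl

theorem losersTruthful_removeProfile (p : Fin n → ℝ) (f : Fin n → ℝ → ℝ)
    (order : Fin n → Situation n k → Fin 3 → Bool) :
    LosersTruthful p (removeProfile p f order) := fun _ _ _ h => by
  simp only [removeProfile, h, if_false]

theorem losersTruthful_repeatProfile (p : Fin n → ℝ) (first : Profile n k) :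
    LosersTruthful p (repeatProfile p first) := fun _ _ _ h => by
  simp only [repeatProfile, h, if_false]

theorem LosersTruthful.target_eq {p : Fin n → ℝ} {σ : Profile n k} (hσ : LosersTruthful p σ)
    {q : Situation n k} {a m c : Fin 3} (h₁ : p (q.owner a) < p (q.owner m))
    (h₂ : p (q.owner m) < p (q.owner c)) {x : Fin n} {j : Fin 3} (hj : j ≠ m) {b : Bool}
    (hb : b ∈ (σ x q j).support) : target j b = m := by
  have hlose : ¬ ShouldWin p q j := fun h => by
    rw [ShouldWin, winner_truthfulBallot h₁ h₂, Option.some_inj] at h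
    exact hj h.symm
  rw [hσ x q j hlose, PMF.support_pure, Set.mem_singleton_iff] at hb
  rw [hb]
  exact target_truthfulBallot h₁ h₂ j hj

theorem LosersTruthful.winner_eq {p : Fin n → ℝ} (hp : Function.Injective p) {σ : Profile n k}
    (hσ : LosersTruthful p σ) {q : Situation n k} (hq : Function.Injective q.owner) {v : Ballot}
    (hv : v ∈ (ballotLaw σ q).support) : winner v = winner (truthfulBallot p q) := by
  obtain ⟨a, m, c, h₁, h₂⟩ := exists_lt_lt (hp.comp hq)
  simp only [Function.comp_apply] at h₁ h₂
  rw [winner_truthfulBallot h₁ h₂]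
  exact winner_eq_some fun j hj => hσ.target_eq h₁ h₂ hj (mem_support_ballotLaw hv j)

theorem next_of_not_injective (p : Fin n → ℝ) {u : Urn n k} {s : Fin 3 → Ball n k}
    (hs : ¬ Function.Injective (u.label ∘ s)) : u.next ⟨s, []⟩ = truthfulNext p u s := by
  simp only [truthfulNext, Urn.next, hs, if_false]

theorem next_of_winner {u : Urn n k} {s : Fin 3 → Ball n k}
    (hs : Function.Injective (u.label ∘ s)) {l : List Ballot} {i : Fin 3}
    (hl : l.findSome? winner = some i) : u.next ⟨s, l⟩ = u.relabel s (u.label (s i)) := by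
  simp only [Urn.next, hs, if_true, hl]

theorem next_of_tie {u : Urn n k} {s : Fin 3 → Ball n k}
    (hs : Function.Injective (u.label ∘ s)) {l : List Ballot}
    (hl : l.findSome? winner = none) : u.next ⟨s, l⟩ = u.remove s := by
  simp only [Urn.next, hs, if_true, hl]

/-- The two outer votes already settle the first ballot, so a second one is never held. -/
theorem LosersTruthful.next_eq {p : Fin n → ℝ} (hp : Function.Injective p) {σ : Profile n k}
    (hσ : LosersTruthful p σ) {m : Mechanism} {l : List (Event n k)} {u : Urn n k}
    {s : Fin 3 → Ball n k} {e : Event n k} (he : e ∈ (sampleLaw m σ l u s).support) :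
    u.next e = truthfulNext p u s := by
  rcases mem_support_sampleLaw he with ⟨hs, rfl⟩ | ⟨hs, v, hv, he⟩
  · exact next_of_not_injective p hs
  · obtain ⟨a, i, c, h₁, h₂⟩ := exists_lt_lt (hp.comp hs)
    simp only [Function.comp_apply] at h₁ h₂
    have hw : winner v = some i :=
      (hσ.winner_eq hp (q := ⟨l, u, s, []⟩) hs hv).trans (winner_truthfulBallot h₁ h₂)
    rcases he with ⟨-, rfl⟩ | ⟨h, -⟩
    · rw [truthfulNext_eq_relabel hs h₁ h₂]
      exact next_of_winner hs (by simp [hw])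
    · rw [hw] at h
      exact absurd h (by simp)

theorem LosersTruthful.toReal_winProb {p : Fin n → ℝ} (hp : Function.Injective p)
    {σ : Profile n k} (hσ : LosersTruthful p σ) (m : Mechanism) {u₀ : Urn n k} (hu₀ : u₀.Proper)
    (w : Fin n) : (winProb m σ u₀ w).toReal = truthfulLaw p u₀ w :=
  toReal_winProb_eq hp (fun _ _ _ _ _ _ he => hσ.next_eq hp he) hu₀ w

theorem LosersTruthful.expectedUtility_eq {p : Fin n → ℝ} (hp : Function.Injective p)
    {σ : Profile n k} (hσ : LosersTruthful p σ) (f : Fin n → ℝ → ℝ) (m : Mechanism)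
    {u₀ : Urn n k} (hu₀ : u₀.Proper) (x : Fin n) :
    expectedUtility p f m σ u₀ x = truthfulValue p (utility p f x) u₀ := by
  simp only [expectedUtility, truthfulValue, hσ.toReal_winProb hp m hu₀]

theorem proper_initialUrn (hn : 0 < n) (hk : 0 < k) : (initialUrn n k).Proper :=
  Or.inl ⟨(⟨0, hn⟩, ⟨0, hk⟩), Finset.mem_univ _⟩

theorem LosersTruthful.isQuasiTruthful {p : Fin n → ℝ} (hp : Function.Injective p)
    {σ : Profile n k} (hσ : LosersTruthful p σ) (m : Mechanism) (hn : 0 < n) (hk : 0 < k) :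
    IsQuasiTruthful p m σ := by
  have hu := proper_initialUrn hn hk
  refine ⟨fun q hq v hv => hσ.winner_eq hp hq hv, fun w => ?_⟩
  rw [← ENNReal.toReal_eq_toReal_iff' (winProb_ne_top m _ hu w) (winProb_ne_top m _ hu w),
    hσ.toReal_winProb hp m hu, (losersTruthful_truthful p).toReal_winProb hp m hu]

/-! ### Unilateral deviations -/

/-- If `i` abandons `m`, he votes for the third candidate, who still votes for `m`. The vote of `m`
decides: given to `i` it closes a cycle, given to the third candidate it elects him. -/
theorem winner_of_deviation {v : Ballot} {m i : Fin 3} (him : i ≠ m) (hi : target i (v i) ≠ m)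
    (h : ∀ j, j ≠ m → j ≠ i → target j (v j) = m) :
    (target m (v m) = i ∧ winner v = none) ∨ ∃ o, o ≠ i ∧ o ≠ m ∧ winner v = some o := by
  revert v m i
  decide

/-- If one participant deviates, then the median wins, or the deviator is not the median and
effects a win of the third candidate or, if the median votes for the deviator, a tie. -/
theorem LosersTruthful.outcome_of_deviation {p : Fin n → ℝ} {σ : Profile n k}
    (hσ : LosersTruthful p σ) {x : Fin n} {τ : Strategy n k} {q : Situation n k}
    (hq : Function.Injective q.owner) {a m c : Fin 3} (h₁ : p (q.owner a) < p (q.owner m))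
    (h₂ : p (q.owner m) < p (q.owner c)) {v : Ballot}
    (hv : v ∈ (ballotLaw (Function.update σ x τ) q).support) :
    winner v = some m ∨ ∃ i, i ≠ m ∧ q.owner i = x ∧
      ((target m (v m) = i ∧ winner v = none ∧ v m ∈ (σ (q.owner m) q m).support) ∨
        ∃ o, o ≠ i ∧ o ≠ m ∧ winner v = some o) := by
  have hsupp : ∀ j, q.owner j ≠ x → v j ∈ (σ (q.owner j) q j).support := fun j hj => by
    have := mem_support_ballotLaw hv j
    rwa [Function.update_of_ne hj] at this
  by_cases hall : ∀ j, j ≠ m → target j (v j) = m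
  · exact Or.inl (winner_eq_some hall)
  · push Not at hall
    obtain ⟨i, him, hi⟩ := hall
    -- Anyone other than the deviator still follows `σ` and hence votes for the median.
    have hix : q.owner i = x := by
      by_contra h
      exact hi (hσ.target_eq h₁ h₂ him (hsupp i h))
    have hne : ∀ j, j ≠ i → q.owner j ≠ x := fun j hj h => hj (hq (h.trans hix.symm))
    refine Or.inr ⟨i, him, hix, ?_⟩
    rcases winner_of_deviation him hi
      (fun j hjm hji => hσ.target_eq h₁ h₂ hjm (hsupp j (hne j hji))) with ⟨h, h'⟩ | h
    · exact Or.inl ⟨h, h', hsupp m (hne m him.symm)⟩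
    · exact Or.inr h

theorem lt_lt_or_lt_lt {P : Fin 3 → ℝ} {a m c i o : Fin 3} (h₁ : P a < P m) (h₂ : P m < P c)
    (him : i ≠ m) (hom : o ≠ m) (hoi : o ≠ i) :
    P i < P m ∧ P m < P o ∨ P o < P m ∧ P m < P i := by
  have ham : a ≠ m := by rintro rfl; exact lt_irrefl _ h₁
  have hmc : m ≠ c := by rintro rfl; exact lt_irrefl _ h₂
  have hac : a ≠ c := by rintro rfl; exact lt_asymm h₁ h₂
  by_cases hia : i = a
  · subst hia
    rw [eq_of_ne_of_ne ham hmc hac hoi hom]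
    exact Or.inl ⟨h₁, h₂⟩
  · have hic := eq_of_ne_of_ne ham hmc hac hia him
    subst hic
    rw [eq_of_ne_of_ne hmc.symm ham.symm hac.symm hoi hom]
    exact Or.inr ⟨h₁, h₂⟩

theorem truthfulValue_relabel_sample_le {p : Fin n → ℝ} (hp : Function.Injective p)
    {f : Fin n → ℝ → ℝ} (hf : ∀ x, StrictAntiOn (f x) (Set.Ici 0)) {u : Urn n k}
    {s : Fin 3 → Ball n k} (hs : s ∈ u.samples) (hinj : Function.Injective (u.label ∘ s))
    {a m c i o : Fin 3} (h₁ : p (u.label (s a)) < p (u.label (s m)))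
    (h₂ : p (u.label (s m)) < p (u.label (s c))) (him : i ≠ m) (hom : o ≠ m) (hoi : o ≠ i) :
    truthfulValue p (utility p f (u.label (s i))) (u.relabel s (u.label (s o))) ≤
      truthfulValue p (utility p f (u.label (s i))) (truthfulNext p u s) := by
  rw [truthfulNext_eq_relabel hinj h₁ h₂]
  exact truthfulValue_relabel_le hp hs
    (lt_lt_or_lt_lt (P := fun i => p (u.label (s i))) h₁ h₂ him hom hoi) (hf _)

/-- It suffices for an equilibrium that no deviation improves the outcome of any event. -/
theorem LosersTruthful.isNashEquilibrium {p : Fin n → ℝ} (hp : Function.Injective p)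
    {f : Fin n → ℝ → ℝ} {σ : Profile n k} (hσ : LosersTruthful p σ) {m : Mechanism}
    (hn : 0 < n) (hk : 0 < k)
    (h : ∀ (x : Fin n) (τ : Strategy n k) (l : List (Event n k)) (u : Urn n k),
      ∀ s ∈ u.samples, Function.Injective (u.label ∘ s) →
      ∀ e ∈ (sampleLaw m (Function.update σ x τ) l u s).support,
        truthfulValue p (utility p f x) (u.next e) ≤
          truthfulValue p (utility p f x) (truthfulNext p u s)) :
    IsNashEquilibrium p f m σ := by
  intro x τ
  have hu := proper_initialUrn hn hk
  rw [hσ.expectedUtility_eq hp f m hu]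
  refine sum_toReal_winProb_mul_le hp (fun l u _ s hs e he => ?_) hu
  by_cases hinj : Function.Injective (u.label ∘ s)
  · exact h x τ l u s hs hinj e he
  · rcases mem_support_sampleLaw he with ⟨_, rfl⟩ | ⟨h', _⟩
    · rw [next_of_not_injective p hinj]
    · exact absurd h' hinj

/-- Truthful play has the explicit law of the winner, also from the urn reached here, so the
preference becomes a comparison of explicit values. -/
theorem prefersWin_iff {p : Fin n → ℝ} (hp : Function.Injective p) (f : Fin n → ℝ → ℝ)
    {q : Situation n k} (hq : q.urn.Proper) (j i : Fin 3) :
    PrefersWin p f q j i ↔ truthfulValue p (utility p f (q.owner j)) (q.urn.remove q.sample) ≤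
      truthfulValue p (utility p f (q.owner j)) (q.urn.relabel q.sample (q.owner i)) := by
  rw [PrefersWin, (losersTruthful_truthful p).expectedUtility_eq hp f _ (Urn.proper_remove _ _),
    (losersTruthful_truthful p).expectedUtility_eq hp f _ (Urn.proper_relabel hq _ _)]

theorem target_ne_target_not (m : Fin 3) (b : Bool) : target m b ≠ target m (!b) := by
  revert m b
  decide

theorem target_ne (m : Fin 3) (b : Bool) : target m b ≠ m := by
  revert m b
  decide

theorem isNashEquilibrium_removeProfile {p : Fin n → ℝ} (hp : Function.Injective p)
    {f : Fin n → ℝ → ℝ} (hf : ∀ x, StrictAntiOn (f x) (Set.Ici 0))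
    (hc : ∀ x, ConcaveOn ℝ (Set.Ici 0) (f x)) (hn : 0 < n) (hk : 0 < k)
    (order : Fin n → Situation n k → Fin 3 → Bool) :
    IsNashEquilibrium p f .remove (removeProfile p f order) := by
  have hσ := losersTruthful_removeProfile p f order
  refine hσ.isNashEquilibrium hp hn hk fun x τ l u s hs hinj e he => ?_
  obtain ⟨a, m, c, h₁, h₂⟩ := exists_lt_lt (hp.comp hinj)
  simp only [Function.comp_apply] at h₁ h₂
  rcases mem_support_sampleLaw he with ⟨h, _⟩ | ⟨_, v, hv, ⟨-, rfl⟩ | ⟨_, h, _⟩⟩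
  · exact absurd hinj h
  · rcases hσ.outcome_of_deviation (q := ⟨l, u, s, []⟩) hinj h₁ h₂ hv with
      hw | ⟨i, him, rfl, ⟨hi, hw, hvm⟩ | ⟨o, hoi, hom, hw⟩⟩
    · rw [next_of_winner hinj (i := m) (by simp [hw]), truthfulNext_eq_relabel hinj h₁ h₂]
    · rw [next_of_tie hinj (by simp [hw]), truthfulNext_eq_relabel hinj h₁ h₂]
      set q : Situation n k := ⟨l, u, s, []⟩ with hq
      have hproper : q.urn.Proper := Or.inl ⟨s 0, Fintype.mem_piFinset.mp hs 0⟩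
      have hwin : ShouldWin p q m := winner_truthfulBallot h₁ h₂
      simp only [removeProfile, hwin, if_true] at hvm
      split_ifs at hvm with hpref
      · rw [PMF.support_pure, Set.mem_singleton_iff] at hvm
        rw [← hvm, hi, prefersWin_iff hp f hproper] at hpref
        exact hpref
      · rw [PMF.support_pure, Set.mem_singleton_iff] at hvm
        rw [prefersWin_iff hp f hproper] at hpref
        -- The median has voted for the deviator because the other outer candidate would profit from
        -- a tie. One of the two does not, so it is the deviator.
        have hoi := target_ne_target_not m (order (q.owner m) q m)
        rw [← hvm, hi] at hoi
        have hsinj : Function.Injective s := hinj.of_comp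
        rcases lt_lt_or_lt_lt (P := fun i => p (u.label (s i))) h₁ h₂ him
          (target_ne m (order (q.owner m) q m)) hoi with ⟨h, h'⟩ | ⟨h, h'⟩
        · exact (truthfulValue_remove_le_or hp hs hsinj h h' hf hc).resolve_right hpref
        · exact (truthfulValue_remove_le_or hp hs hsinj h h' hf hc).resolve_left hpref
    · rw [next_of_winner hinj (i := o) (by simp [hw])]
      exact truthfulValue_relabel_sample_le hp hf hs hinj h₁ h₂ him hom hoi
  · exact absurd h (by simp)

theorem isNashEquilibrium_repeatProfile {p : Fin n → ℝ} (hp : Function.Injective p)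
    {f : Fin n → ℝ → ℝ} (hf : ∀ x, StrictAntiOn (f x) (Set.Ici 0))
    (hn : 0 < n) (hk : 0 < k) (first : Profile n k) :
    IsNashEquilibrium p f .repeatThenRemove (repeatProfile p first) := by
  have hσ := losersTruthful_repeatProfile p first
  refine hσ.isNashEquilibrium hp hn hk fun x τ l u s hs hinj e he => ?_
  obtain ⟨a, m, c, h₁, h₂⟩ := exists_lt_lt (hp.comp hinj)
  simp only [Function.comp_apply] at h₁ h₂
  have hmed : ∀ b : List Ballot, b.findSome? winner = some m →
      truthfulValue p (utility p f x) (u.next ⟨s, b⟩) ≤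
        truthfulValue p (utility p f x) (truthfulNext p u s) := fun b hb => by
    rw [next_of_winner hinj hb, truthfulNext_eq_relabel hinj h₁ h₂]
  have hother : ∀ (b : List Ballot) (i o : Fin 3), i ≠ m → u.label (s i) = x → o ≠ i → o ≠ m →
      b.findSome? winner = some o → truthfulValue p (utility p f x) (u.next ⟨s, b⟩) ≤
        truthfulValue p (utility p f x) (truthfulNext p u s) := by
    rintro b i o him rfl hoi hom hb
    rw [next_of_winner hinj hb]
    exact truthfulValue_relabel_sample_le hp hf hs hinj h₁ h₂ him hom hoi
  rcases mem_support_sampleLaw he with ⟨h, _⟩ | ⟨_, v, hv, he⟩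
  · exact absurd hinj h
  · rcases hσ.outcome_of_deviation (q := ⟨l, u, s, []⟩) hinj h₁ h₂ hv with
      hw | ⟨i, him, hix, ⟨hi, hw, -⟩ | ⟨o, hoi, hom, hw⟩⟩
    · rcases he with ⟨-, rfl⟩ | ⟨h, -⟩
      · exact hmed _ (by simp [hw])
      · exact absurd h (by simp [hw])
    · rcases he with ⟨h, -⟩ | ⟨-, -, v', hv', rfl⟩
      · exact absurd ⟨hw, rfl⟩ h
      · rcases hσ.outcome_of_deviation (q := ⟨l, u, s, [v]⟩) hinj h₁ h₂ hv' with
          hw' | ⟨i', him', hix', ⟨hi', -, hvm⟩ | ⟨o, hoi, hom, hw'⟩⟩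
        · exact hmed _ (by simp [hw, hw'])
        · have hwin : ShouldWin p (⟨l, u, s, [v]⟩ : Situation n k) m :=
            winner_truthfulBallot h₁ h₂
          simp only [repeatProfile, hwin, if_true, PMF.support_pure,
            Set.mem_singleton_iff] at hvm
          -- The labels are distinct, so the deviator owns the same ball in both ballots. Two ties
          -- would require the median to vote for him twice, but the median switches.
          have hii : i' = i := hinj (hix'.trans hix.symm)
          rw [hvm, hii, ← hi] at hi'
          exact absurd hi'.symm (target_ne_target_not m (v m))
        · exact hother _ i' o him' hix' hoi hom (by simp [hw, hw'])
    · rcases he with ⟨-, rfl⟩ | ⟨h, -⟩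
      · exact hother _ i o him hix hoi hom (by simp [hw])
      · exact absurd h (by simp [hw])

/-! ### An instance with untruthful votes -/

/-- Four positions such that the second participant votes for the first one rather than for the
third one, who is closer. -/
noncomputable def samplePositions : Fin 4 → ℝ := ![-4, 0, 2, 3]

theorem strictMono_samplePositions : StrictMono samplePositions := by
  rw [Fin.strictMono_iff_lt_succ]
  intro i
  fin_cases i
  · exact show (-4 : ℝ) < 0 by norm_num
  · exact show (0 : ℝ) < 2 by norm_num
  · exact show (2 : ℝ) < 3 by norm_num

/-- The first three balls are drawn from the starting urn. -/
def sampleOpening : Situation 4 1 := ⟨[], initialUrn 4 1, ![(0, 0), (1, 0), (2, 0)], []⟩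

theorem upTo_of_strictMono {p : Fin n → ℝ} (hp : StrictMono p) (w : Fin n) :
    upTo p w = Finset.Iic w := by
  ext v
  simp [upTo, hp.le_iff_le]

theorem leftOf_of_strictMono {p : Fin n → ℝ} (hp : StrictMono p) (w : Fin n) :
    leftOf p w = Finset.Iio w := by
  ext v
  simp [leftOf, hp.lt_iff_lt]

/-- The urn holds three balls of participant 1 and one of participant 3, and 7/8 = (1 + 3 + 3)/2³.
-/
theorem truthfulLaw_relabel_sampleOpening (w : Fin 4) :
    truthfulLaw samplePositions (sampleOpening.urn.relabel sampleOpening.sample 1) w =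
      ![0, 7 / 8, 0, 1 / 8] w := by
  have hcard : (sampleOpening.urn.relabel sampleOpening.sample 1).alive.card = 4 := by decide
  have hne : (sampleOpening.urn.relabel sampleOpening.sample 1).alive.Nonempty :=
    Finset.card_pos.mp (by omega)
  have hle : ∀ w : Fin 4, countIn (sampleOpening.urn.relabel sampleOpening.sample 1)
      (Finset.Iic w) = ![0, 3, 3, 4] w := by decide
  have hlt : ∀ w : Fin 4, countIn (sampleOpening.urn.relabel sampleOpening.sample 1)
      (Finset.Iio w) = ![0, 0, 3, 3] w := by decide
  rw [truthfulLaw, if_pos hne, hcard, upTo_of_strictMono strictMono_samplePositions,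
    leftOf_of_strictMono strictMono_samplePositions, hle, hlt]
  fin_cases w <;> norm_num [lowProb, Finset.sum_range_succ, Nat.choose]

theorem truthfulLaw_remove_sampleOpening (w : Fin 4) :
    truthfulLaw samplePositions (sampleOpening.urn.remove sampleOpening.sample) w =
      ![0, 0, 0, 1] w := by
  have hcard : (sampleOpening.urn.remove sampleOpening.sample).alive.card = 1 := by decide
  have hne : (sampleOpening.urn.remove sampleOpening.sample).alive.Nonempty :=
    Finset.card_pos.mp (by omega)
  have hle : ∀ w : Fin 4, countIn (sampleOpening.urn.remove sampleOpening.sample)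
      (Finset.Iic w) = ![0, 0, 0, 1] w := by decide
  have hlt : ∀ w : Fin 4, countIn (sampleOpening.urn.remove sampleOpening.sample)
      (Finset.Iio w) = ![0, 0, 0, 0] w := by decide
  rw [truthfulLaw, if_pos hne, hcard, upTo_of_strictMono strictMono_samplePositions,
    leftOf_of_strictMono strictMono_samplePositions, hle, hlt]
  fin_cases w <;> norm_num [lowProb, Finset.sum_range_succ, Nat.choose]

theorem owner_sampleOpening (i : Fin 3) : sampleOpening.owner i = ![0, 1, 2] i := by
  fin_cases i <;> rfl

theorem injective_owner_sampleOpening : Function.Injective sampleOpening.owner := by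
  rw [funext owner_sampleOpening]
  decide

theorem shouldWin_sampleOpening : ShouldWin samplePositions sampleOpening 1 :=
  winner_truthfulBallot (a := 0) (c := 2) (strictMono_samplePositions (by decide))
    (strictMono_samplePositions (by decide))

theorem proper_sampleOpening : sampleOpening.urn.Proper :=
  proper_initialUrn (by norm_num) (by norm_num)

/-- From position -4 the expected distance to the winner is 4·7/8 + 7·1/8 = 35/8 after the win, but
7 after the removal. -/
theorem prefersWin_sampleOpening :
    PrefersWin samplePositions (fun _ d => -d) sampleOpening 0 1 := by
  rw [prefersWin_iff strictMono_samplePositions.injective _ proper_sampleOpening,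
    owner_sampleOpening, owner_sampleOpening]
  simp only [truthfulValue, Fin.sum_univ_four, truthfulLaw_remove_sampleOpening, Matrix.cons_val,
    truthfulLaw_relabel_sampleOpening]
  simp only [utility, samplePositions, Matrix.cons_val, Real.dist_eq]
  norm_num

/-- From position 2 the expected distance is 2·7/8 + 1·1/8 = 15/8 after the win, but only 1 after
the removal. -/
theorem not_prefersWin_sampleOpening :
    ¬ PrefersWin samplePositions (fun _ d => -d) sampleOpening 2 1 := by
  rw [prefersWin_iff strictMono_samplePositions.injective _ proper_sampleOpening,
    owner_sampleOpening, owner_sampleOpening]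
  simp only [truthfulValue, Fin.sum_univ_four, truthfulLaw_remove_sampleOpening, Matrix.cons_val,
    truthfulLaw_relabel_sampleOpening]
  simp only [utility, samplePositions, Matrix.cons_val, Real.dist_eq]
  norm_num

theorem hasUntruthfulOpening_of_mem {σ : Profile 4 1}
    (h : true ∈ (σ (sampleOpening.owner 1) sampleOpening 1).support) :
    HasUntruthfulOpening samplePositions σ := by
  refine ⟨sampleOpening, rfl, rfl, rfl, injective_owner_sampleOpening, 1, true, h, ?_⟩
  simp only [owner_sampleOpening]
  rw [show target 1 (!true) = 2 from rfl, show target 1 true = 0 from rfl]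
  simp only [Matrix.cons_val, samplePositions, Real.dist_eq]
  norm_num

/-- Exactly one of the two candidates prefers the win, so both orders lead to a vote for participant
0, at distance 4, instead of participant 2, at distance 2. -/
theorem hasUntruthfulOpening_removeProfile (order : Fin 4 → Situation 4 1 → Fin 3 → Bool) :
    HasUntruthfulOpening samplePositions
      (removeProfile samplePositions (fun _ d => -d) order) := by
  refine hasUntruthfulOpening_of_mem ?_
  simp only [removeProfile, shouldWin_sampleOpening, if_true]
  cases order (sampleOpening.owner 1) sampleOpening 1 with
  | true =>
    rw [show target 1 true = 0 from rfl, if_pos prefersWin_sampleOpening]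
    simp
  | false =>
    rw [show target 1 false = 2 from rfl, if_neg not_prefersWin_sampleOpening]
    simp

theorem hasUntruthfulOpening_repeatProfile :
    HasUntruthfulOpening samplePositions
      (repeatProfile samplePositions (fun _ _ _ => PMF.pure true : Profile 4 1)) := by
  refine hasUntruthfulOpening_of_mem ?_
  simp only [repeatProfile, shouldWin_sampleOpening, if_true]
  simp [sampleOpening]

end TriadicConsensus

theorem mainTheorem4 :
    (∀ (n k : ℕ), 0 < n → 0 < k →
      ∀ (p : Fin n → ℝ), Function.Injective p →
      ∀ (f : Fin n → ℝ → ℝ),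
        (∀ x, StrictAntiOn (f x) (Set.Ici 0)) →
        (∀ x, ConcaveOn ℝ (Set.Ici 0) (f x)) →
        (∀ (m : TriadicConsensus.Mechanism) (σ : TriadicConsensus.Profile n k),
          ∑ w, TriadicConsensus.winProb m σ (TriadicConsensus.initialUrn n k) w = 1) ∧
        (∀ order : Fin n → TriadicConsensus.Situation n k → Fin 3 → Bool,
          TriadicConsensus.IsNashEquilibrium p f .remove
            (TriadicConsensus.removeProfile p f order) ∧
          TriadicConsensus.IsQuasiTruthful p .remove
            (TriadicConsensus.removeProfile p f order)) ∧
        (∀ first : TriadicConsensus.Profile n k,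
          TriadicConsensus.IsNashEquilibrium p f .repeatThenRemove
            (TriadicConsensus.repeatProfile p first) ∧
          TriadicConsensus.IsQuasiTruthful p .repeatThenRemove
            (TriadicConsensus.repeatProfile p first))) ∧
    (∃ (n k : ℕ) (p : Fin n → ℝ) (f : Fin n → ℝ → ℝ),
      0 < n ∧ 0 < k ∧ Function.Injective p ∧
      (∀ x, StrictAntiOn (f x) (Set.Ici 0)) ∧
      (∀ x, ConcaveOn ℝ (Set.Ici 0) (f x)) ∧
      (∀ order : Fin n → TriadicConsensus.Situation n k → Fin 3 → Bool,
        TriadicConsensus.HasUntruthfulOpening p (TriadicConsensus.removeProfile p f order)) ∧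
      (∃ first : TriadicConsensus.Profile n k,
        TriadicConsensus.HasUntruthfulOpening p (TriadicConsensus.repeatProfile p first))) := by
  refine ⟨fun n k hn hk p hp f hf hc => ⟨fun m σ => ?_, fun order => ⟨?_, ?_⟩,
    fun first => ⟨?_, ?_⟩⟩, 4, 1, TriadicConsensus.samplePositions, fun _ d => -d, by norm_num,
    by norm_num, TriadicConsensus.strictMono_samplePositions.injective, ?_, ?_,
    TriadicConsensus.hasUntruthfulOpening_removeProfile,
    ⟨_, TriadicConsensus.hasUntruthfulOpening_repeatProfile⟩⟩
  · exact TriadicConsensus.sum_winProb m σ (TriadicConsensus.proper_initialUrn hn hk)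
  · exact TriadicConsensus.isNashEquilibrium_removeProfile hp hf hc hn hk order
  · exact (TriadicConsensus.losersTruthful_removeProfile p f order).isQuasiTruthful hp _ hn hk
  · exact TriadicConsensus.isNashEquilibrium_repeatProfile hp hf hn hk first
  · exact (TriadicConsensus.losersTruthful_repeatProfile p first).isQuasiTruthful hp _ hn hk
  · exact fun _ _ _ _ _ h => neg_lt_neg h
  · exact fun _ => (convexOn_id (convex_Ici 0)).neg
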